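/- Types are built from primitive types $p_0,p_1,p_2,\dots$ by the connectives $\cdot$, $\backslash$, $/$. The Lambek calculus $\mathbf L$ derives sequents $\Pi\to A$, where $A$ is a type and $\Pi$ is a non-empty finite sequence of types, from the axioms $A\to A$ by the following rules: (i) from $A,\Pi\to B$ with $\Pi$ non-empty infer $\Pi\to A\backslash B$; (ii) from $\Pi,A\to B$ with $\Pi$ non-empty infer $\Pi\to B/A$; (iii) from $\Pi\to A$ and $\Gamma,B,\Delta\to C$ infer $\Gamma,\Pi,A\backslash B,\Delta\to C$ and $\Gamma,B/A,\Pi,\Delta\to C$; (iv) from $\Gamma\to A$ and $\Delta\to B$ infer $\Gamma,\Delta\to A\cdot B$; (v) from $\Gamma,A,B,\Delta\to C$ infer $\Gamma,A\cdot B,\Delta\to C$. A Lambek categorial grammar with unique type assignment over a finite alphabet $\{a_1,\dots,a_n\}$ consists of $n+1$ types: one type $A_i$ for each letter $a_i$, and a target type $H$. A word $a_{i_1}\dots a_{i_m}$ with $m\ge 1$ belongs to the language generated by this grammar if and only if $A_{i_1},\dots,A_{i_m}\to H$ is derivable in $\mathbf L$; the empty word never belongs to it. Theorem. Every context-free language over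 a finite alphabet that does not contain the empty word is generated by a Lambek categorial grammar with unique type assignment. Moreover, such a grammar can be constructed effectively: there is an algorithm which, given any context-free grammar $\mathcal G$ without $\varepsilon$-rules (together with its alphabet $\{a_1,\dots,a_n\}$), computes types $A_1,\dots,A_n,H$ forming a Lambek categorial grammar with unique type assignment that generates the language of $\mathcal G$. -/

import Mathlib

namespace Lambek

/-- Types of the Lambek calculus: built from the countable set of primitive types
`prim 0, prim 1, …` by product and the two divisions. -/
inductive Tp : Type
  /-- a primitive type -/
  | prim (n : ℕ) : Tp
  /-- the product `A · B` -/
  | mul (A B : Tp) : Tp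
  /-- left division `A \ B` (denominator `A`, numerator `B`) -/
  | ldiv (A B : Tp) : Tp
  /-- right division `B / A` (numerator `B`, denominator `A`) -/
  | rdiv (B A : Tp) : Tp

/-- `Derivable Γ C`: the sequent `Γ → C` is derivable in the (cut-free) Lambek calculus `L` with
Lambek's non-emptiness restriction. The side conditions `Φ ≠ []` are the ones on the right rules
for the divisions; all other rules preserve non-emptiness of antecedents. -/
inductive Derivable : List Tp → Tp → Prop
  | ax (A : Tp) : Derivable [A] A
  | ldiv_right {Φ : List Tp} {A B : Tp} (hne : Φ ≠ []) (h : Derivable ([A] ++ Φ) B) :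
      Derivable Φ (.ldiv A B)
  | ldiv_left {Γ Φ Δ : List Tp} {A B C : Tp} (h₁ : Derivable Φ A)
      (h₂ : Derivable (Γ ++ [B] ++ Δ) C) :
      Derivable (Γ ++ Φ ++ [.ldiv A B] ++ Δ) C
  | rdiv_right {Φ : List Tp} {A B : Tp} (hne : Φ ≠ []) (h : Derivable (Φ ++ [A]) B) :
      Derivable Φ (.rdiv B A)
  | rdiv_left {Γ Φ Δ : List Tp} {A B C : Tp} (h₁ : Derivable Φ A)
      (h₂ : Derivable (Γ ++ [B] ++ Δ) C) :
      Derivable (Γ ++ [.rdiv B A] ++ Φ ++ Δ) C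
  | mul_right {Γ Δ : List Tp} {A B : Tp} (h₁ : Derivable Γ A) (h₂ : Derivable Δ B) :
      Derivable (Γ ++ Δ) (.mul A B)
  | mul_left {Γ Δ : List Tp} {A B C : Tp} (h : Derivable (Γ ++ [A, B] ++ Δ) C) :
      Derivable (Γ ++ [.mul A B] ++ Δ) C

/-- The antecedent of a derivable sequent is non-empty. -/
theorem Derivable.ne_nil {Γ : List Tp} {C : Tp} (h : Derivable Γ C) : Γ ≠ [] := by
  induction h <;> simp_all

/-- A Lambek categorial grammar with unique type assignment over the alphabet `T`: one type for
each letter and a target type. -/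
structure UniqueGrammar (T : Type*) where
  /-- the type assigned to a letter -/
  assign : T → Tp
  /-- the target type -/
  target : Tp

/-- The language generated by a Lambek grammar with unique type assignment: `a₁ … aₘ` belongs to
it iff the sequent `A₁, …, Aₘ → H` is derivable, where `Aᵢ` is the type of `aᵢ` and `H` is the
target type. The empty word never belongs to it, because no sequent with an empty antecedent is
derivable. -/
def UniqueGrammar.language {T : Type*} (g : UniqueGrammar T) : Language T :=
  {w : List T | Derivable (w.map g.assign) g.target}

/-- Gödel numbers of Lambek types. -/
def Tp.code : Tp → ℕ
  | .prim n => 4 * n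
  | .mul A B => 4 * Nat.pair A.code B.code + 1
  | .ldiv A B => 4 * Nat.pair A.code B.code + 2
  | .rdiv B A => 4 * Nat.pair B.code A.code + 3

/-- The Lambek type with a given Gödel number. -/
def Tp.ofCode (n : ℕ) : Tp :=
  if _h0 : n % 4 = 0 then .prim (n / 4)
  else if n % 4 = 1 then .mul (Tp.ofCode (n / 4).unpair.1) (Tp.ofCode (n / 4).unpair.2)
  else if n % 4 = 2 then .ldiv (Tp.ofCode (n / 4).unpair.1) (Tp.ofCode (n / 4).unpair.2)
  else .rdiv (Tp.ofCode (n / 4).unpair.1) (Tp.ofCode (n / 4).unpair.2)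
termination_by n
decreasing_by
  all_goals
    have h₁ := Nat.unpair_left_le (n / 4)
    have h₂ := Nat.unpair_right_le (n / 4)
    omega

theorem Tp.ofCode_code (A : Tp) : Tp.ofCode A.code = A := by
  induction A with
  | prim n =>
    rw [Tp.code, Tp.ofCode]
    simp
  | mul A B ihA ihB =>
    rw [Tp.code, Tp.ofCode]
    have h₁ : (4 * Nat.pair A.code B.code + 1) % 4 = 1 := by omega
    have h₂ : (4 * Nat.pair A.code B.code + 1) / 4 = Nat.pair A.code B.code := by omega
    simp [h₁, h₂, ihA, ihB]
  | ldiv A B ihA ihB =>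
    rw [Tp.code, Tp.ofCode]
    have h₁ : (4 * Nat.pair A.code B.code + 2) % 4 = 2 := by omega
    have h₂ : (4 * Nat.pair A.code B.code + 2) / 4 = Nat.pair A.code B.code := by omega
    simp [h₁, h₂, ihA, ihB]
  | rdiv B A ihB ihA =>
    rw [Tp.code, Tp.ofCode]
    have h₁ : (4 * Nat.pair B.code A.code + 3) % 4 = 3 := by omega
    have h₂ : (4 * Nat.pair B.code A.code + 3) / 4 = Nat.pair B.code A.code := by omega
    simp [h₁, h₂, ihA, ihB]

theorem Tp.code_ofCode (n : ℕ) : (Tp.ofCode n).code = n := by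
  induction n using Nat.strong_induction_on with
  | _ n ih =>
    have hl := Nat.unpair_left_le (n / 4)
    have hr := Nat.unpair_right_le (n / 4)
    rw [Tp.ofCode]
    split_ifs with h0 h1 h2
    · rw [Tp.code]; omega
    · rw [Tp.code, ih _ (by omega), ih _ (by omega), Nat.pair_unpair]; omega
    · rw [Tp.code, ih _ (by omega), ih _ (by omega), Nat.pair_unpair]; omega
    · rw [Tp.code, ih _ (by omega), ih _ (by omega), Nat.pair_unpair]; omega

/-- Gödel numbering is a bijection between Lambek types and natural numbers. -/
def Tp.equivNat : Tp ≃ ℕ where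
  toFun := Tp.code
  invFun := Tp.ofCode
  left_inv := Tp.ofCode_code
  right_inv := Tp.code_ofCode

instance : Primcodable Tp := Primcodable.ofEquiv ℕ Tp.equivNat

/-- A context-free grammar as a finite object that an algorithm can take as its input. The alphabet
is `{0, …, numTerminals - 1}`, the nonterminals are numbered by natural numbers, and in the
right-hand side of a rule `Sum.inl a` is the terminal `a` and `Sum.inr N` is the nonterminal `N`. -/
structure CFGData : Type where
  /-- the number of letters of the alphabet -/
  numTerminals : ℕ
  /-- the initial nonterminal -/
  initial : ℕ
  /-- the rules: left-hand side and right-hand side -/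
  rules : List (ℕ × List (ℕ ⊕ ℕ))

namespace CFGData

/-- A grammar as a tuple. -/
def equivProd : CFGData ≃ ℕ × ℕ × List (ℕ × List (ℕ ⊕ ℕ)) where
  toFun G := (G.numTerminals, G.initial, G.rules)
  invFun x := ⟨x.1, x.2.1, x.2.2⟩
  left_inv _ := rfl
  right_inv _ := rfl

instance : Primcodable CFGData := Primcodable.ofEquiv _ equivProd

/-- All terminals in the rules belong to the alphabet. -/
def WellFormed (G : CFGData) : Prop :=
  ∀ r ∈ G.rules, ∀ a : ℕ, Sum.inl a ∈ r.2 → a < G.numTerminals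

/-- There are no rules with an empty right-hand side. -/
def EpsilonFree (G : CFGData) : Prop :=
  ∀ r ∈ G.rules, r.2 ≠ []

/-- A terminal or nonterminal symbol from its description. -/
def toSymbol : ℕ ⊕ ℕ → Symbol ℕ ℕ
  | .inl a => .terminal a
  | .inr N => .nonterminal N

/-- The context-free grammar described by the data. -/
def toCFG (G : CFGData) : ContextFreeGrammar ℕ where
  NT := ℕ
  initial := G.initial
  rules := (G.rules.map fun r => (⟨r.1, r.2.map toSymbol⟩ : ContextFreeRule ℕ ℕ)).toFinset

/-- The language generated by the grammar, over the alphabet of `numTerminals` letters. -/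
def language (G : CFGData) : Language (Fin G.numTerminals) :=
  {w : List (Fin G.numTerminals) | w.map Fin.val ∈ G.toCFG.language}

end CFGData

end Lambek

/-!
A context-free grammar without `ε`-rules is first brought into Greibach normal form: every rule is
`N → a N₁ … Nₖ` with a letter `a`, and the type assigned to `a` has to serve all the rules of `a` at
once.

**The types.** A nonterminal `q` gets the type `ntTp s q = t / K_q`, where the continuation type
`K_q` is `e`, then a row of `s` slots with a mark in place `q`, then a type that turns all of this
into `t`. The rule `q → a q₁ … qₖ` needs a letter that can be followed by
`ruleTp = (t / K_{q₁}) · … · (t / K_{qₖ}) · K_q` to yield `t`. So the letter is given the type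
`t / Z`, where `Z` is an upper bound (`joinTp`) of the types `ruleTp` of the rules of `a`. In the
Lambek calculus finitely many types have an upper bound if they have a lower bound, and here `lowTp`
is one for all rules: a marked slot implies an unmarked one by type raising, so the continuation
type with all slots marked implies every `K_q`, and `e / e` implies every `t / K_q`. Hence each
derivation of the Greibach grammar gives a derivation in the Lambek calculus (`Greibach.derivable`).

**The converse.** The calculus is sound for the interpretation of types by languages of non-empty
words, in which products and divisions are those of languages. In the model used here a word belongs
to `t` if it is `u`, `start`, `β`, `halt`, where `β` is a row of slots and `u` either is empty, or is
a word of letters generated by a nonterminal that is marked in `β`, or contains the letter reserved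
for `e / e`. Every letter belongs to its own type in this model, while `t / K_q` contains no words
of letters but those generated by `q`. This gives `derivable_letterTp_iff`; cut elimination is not
needed.

**The normal form.** The left-corner transformation produces the Greibach rules directly: the
nonterminals are the symbols of the grammar and the pairs `Y / X`, which generate the non-empty
words that complete an initial `X` to a `Y` (`greibach_lcRules_iff`). Unit rules are absorbed by
their transitive closure, for which Warshall's algorithm is used, since everything has to be
computable. The construction is primitive recursive (`primrec_lambekGrammar`).

An arbitrary context-free language without the empty word is reduced to this case by the deletion of
nullable symbols and a numbering of the letters and nonterminals.
-/

namespace Lambek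

/-! ### The types and the derivations -/

/-- The iterated product `A₁ · (A₂ · (… · (Aₙ · B)))`. -/
def prods (l : List Tp) (B : Tp) : Tp := l.foldr Tp.mul B

theorem Derivable.prods_right {Γs : List (List Tp)} {l : List Tp} {Δ : List Tp} {B : Tp}
    (h : List.Forall₂ Derivable Γs l) (hB : Derivable Δ B) :
    Derivable (Γs.flatten ++ Δ) (prods l B) := by
  induction h with
  | nil => simpa [prods] using hB
  | cons h _ ih =>
    simpa [prods, List.append_assoc] using Derivable.mul_right h ih

theorem Derivable.prods_left {l : List Tp} {B C : Tp} {Γ Δ : List Tp}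
    (h : Derivable (Γ ++ (l ++ [B]) ++ Δ) C) : Derivable (Γ ++ [prods l B] ++ Δ) C := by
  induction l generalizing Γ with
  | nil => simpa [prods] using h
  | cons A l ih =>
    have : Derivable ((Γ ++ [A]) ++ [prods l B] ++ Δ) C := ih (by simpa using h)
    exact Derivable.mul_left (A := A) (B := prods l B) (by simpa using this)

/-- The marked slot: a primitive type. -/
def markTp : Tp := .prim 2

/-- The unmarked slot, obtained from `markTp` by type raising, so that `markTp → anyTp` is
derivable but not conversely. -/
def anyTp : Tp := .rdiv (.prim 3) (.ldiv markTp (.prim 3))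

/-- The type of a slot, marked or not. -/
def slotTp (c : Bool) : Tp := if c then markTp else anyTp

/-- The type `e / e`, which an adjacent `e` absorbs. -/
def idTp : Tp := .rdiv (.prim 1) (.prim 1)

/-- The type that turns `e` followed by `n` slots into `t`. -/
def endTp : ℕ → Tp
  | 0 => .ldiv (.prim 1) (.prim 0)
  | n + 1 => .ldiv anyTp (endTp n)

/-- The continuation type of a mark pattern: `e`, then the slots, then the closing type. -/
def contTp (m : List Bool) : Tp := .mul (.prim 1) (prods (m.map slotTp) (endTp m.length))

/-- The pattern of length `s` with its only mark at position `q`. -/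
def oneHot (s q : ℕ) : List Bool := (List.range s).map fun i => decide (i = q)

/-- The type of the nonterminal `q`. The continuation types of different nonterminals differ in the
place of the mark. -/
def ntTp (s q : ℕ) : Tp := .rdiv (.prim 0) (contTp (oneHot s q))

/-- What has to follow a letter if the rule with left-hand side `r.1` and right-hand side
that letter and then `r.2` is used at it. -/
def ruleTp (s : ℕ) (r : ℕ × List ℕ) : Tp := prods (r.2.map (ntTp s)) (contTp (oneHot s r.1))

/-- A common lower bound of all `ruleTp s r` with `r.2.length ≤ L`. -/
def lowTp (s L : ℕ) : Tp :=
  prods (List.replicate (L + 1) idTp) (contTp (List.replicate s true))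

/-- A lower bound of `C` and of the types in a list, provided that `C` is an upper bound of them. -/
def meetTp (C : Tp) : List Tp → Tp
  | [] => C
  | B :: l => .mul (.rdiv (meetTp C l) C) (.mul C (.ldiv C B))

/-- The type `(A · b) \ z`, where `z` is the primitive type reserved for the letter `a`. -/
def dualTp (a : ℕ) (A : Tp) : Tp := .ldiv (.mul A (.prim 4)) (.prim (a + 5))

/-- An upper bound of the types `ruleTp s r` for `r` in the list `R`. `dualTp` reverses the order, so
the dual of the lower bound `lowTp s L` is above the duals of the types `ruleTp s r`, as `meetTp`
needs. -/
def joinTp (s L a : ℕ) (R : List (ℕ × List ℕ)) : Tp :=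
  .rdiv (.prim (a + 5))
    (.mul (.prim 4) (meetTp (dualTp a (lowTp s L)) (R.map fun r => dualTp a (ruleTp s r))))

/-- The type of the letter `a`, where `R` lists the rules that begin with `a`. -/
def letterTp (s L a : ℕ) (R : List (ℕ × List ℕ)) : Tp := .rdiv (.prim 0) (joinTp s L a R)

theorem slotTp_derivable_any (c : Bool) : Derivable [slotTp c] anyTp := by
  cases c
  · exact .ax _
  · refine .rdiv_right (by simp) ?_
    exact .ldiv_left (Γ := []) (Φ := [markTp]) (Δ := []) (.ax _) (.ax _)

theorem idTp_absorb (n : ℕ) : Derivable (List.replicate n idTp ++ [.prim 1]) (.prim 1) := by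
  induction n with
  | zero => exact .ax _
  | succ n ih =>
    simpa [List.replicate_succ, idTp] using
      Derivable.rdiv_left (Γ := []) (Δ := []) ih (.ax (.prim 1))

theorem slots_endTp {Γ : List Tp} (hΓ : Derivable Γ (.prim 1)) (m : List Bool) :
    Derivable (Γ ++ m.map slotTp ++ [endTp m.length]) (.prim 0) := by
  induction m using List.reverseRecOn with
  | nil => simpa [endTp] using Derivable.ldiv_left (Γ := []) (Δ := []) hΓ (.ax (.prim 0))
  | append_singleton m c ih =>
    have := Derivable.ldiv_left (Γ := Γ ++ m.map slotTp) (Δ := []) (slotTp_derivable_any c)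
      (by simpa using ih)
    simpa [endTp] using this

theorem idTp_derivable_ntTp (s q : ℕ) : Derivable [idTp] (ntTp s q) := by
  refine .rdiv_right (by simp) ?_
  refine .mul_left (Γ := [idTp]) (Δ := []) ?_
  have := Derivable.prods_left (Γ := [idTp, .prim 1]) (Δ := []) (C := .prim 0)
    (by simpa using slots_endTp (idTp_absorb 1) (oneHot s q))
  simpa using this

theorem lowTp_cont (n s q : ℕ) : Derivable
    (List.replicate n idTp ++ [contTp (List.replicate s true)]) (contTp (oneHot s q)) := by
  have h1 : Derivable ((List.replicate s true).map slotTp ++ [endTp s])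
      (prods ((oneHot s q).map slotTp) (endTp s)) := by
    have := Derivable.prods_right (Γs := (List.replicate s markTp).map fun A => [A])
      (l := (oneHot s q).map slotTp) (Δ := [endTp s]) ?_ (.ax _)
    · simpa [slotTp] using this
    · rw [List.forall₂_iff_get]
      refine ⟨by simp [oneHot], fun i h₁ h₂ => ?_⟩
      simp only [List.get_eq_getElem, List.getElem_map, List.getElem_replicate]
      cases (oneHot s q)[i]'(by simpa using h₂)
      · exact slotTp_derivable_any true
      · exact .ax _
  have h2 := Derivable.mul_right (idTp_absorb n) h1
  have h3 := Derivable.prods_left (Γ := List.replicate n idTp ++ [.prim 1]) (Δ := [])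
    (l := (List.replicate s true).map slotTp) (B := endTp s) (by simpa using h2)
  have h4 := Derivable.mul_left (Γ := List.replicate n idTp) (Δ := []) (by simpa using h3)
  simpa [contTp, oneHot] using h4

theorem lowTp_derivable_ruleTp {s L : ℕ} {r : ℕ × List ℕ} (h : r.2.length ≤ L) :
    Derivable [lowTp s L] (ruleTp s r) := by
  obtain ⟨k, hk⟩ : ∃ k, L + 1 = r.2.length + k := ⟨L + 1 - r.2.length, by omega⟩
  have h1 : List.Forall₂ Derivable (List.replicate r.2.length [idTp]) (r.2.map (ntTp s)) := by
    rw [List.forall₂_iff_get]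
    refine ⟨by simp, fun i h₁ h₂ => ?_⟩
    simpa using idTp_derivable_ntTp s _
  have h2 := Derivable.prods_right h1 (lowTp_cont k s r.1)
  have h3 := Derivable.prods_left (Γ := []) (Δ := []) (l := List.replicate (L + 1) idTp)
    (B := contTp (List.replicate s true)) (C := ruleTp s r) (by
      rw [List.nil_append, List.append_nil, hk, ← List.replicate_append_replicate,
        List.append_assoc]
      rwa [List.flatten_replicate_singleton] at h2)
  simpa [lowTp] using h3

/-- If `C` is above every type in the list `l`, then the antecedent `meetTp C l` may stand for
`C` and for every element of `l`. -/
theorem meetTp_left {C : Tp} {l : List Tp} (hl : ∀ B ∈ l, Derivable [B] C) {B : Tp}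
    (hB : B = C ∨ B ∈ l) {Γ Δ : List Tp} {X : Tp} (h : Derivable (Γ ++ [B] ++ Δ) X) :
    Derivable (Γ ++ [meetTp C l] ++ Δ) X := by
  induction l generalizing B Γ Δ X with
  | nil =>
    obtain rfl : B = C := by simpa using hB
    exact h
  | cons A l ih =>
    have hl' : ∀ B ∈ l, Derivable [B] C := fun B hB => hl B (by simp [hB])
    refine .mul_left ?_
    suffices Derivable (Γ ++ [.rdiv (meetTp C l) C] ++ [C, .ldiv C A] ++ Δ) X by
      have := Derivable.mul_left (Γ := Γ ++ [.rdiv (meetTp C l) C]) (Δ := Δ) this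
      simpa using this
    by_cases hA : B = A
    · subst hA
      have h1 : Derivable [.rdiv (meetTp C l) C, C] C := by
        have := Derivable.rdiv_left (Γ := []) (Δ := []) (.ax C)
          (ih hl' (Or.inl rfl) (Γ := []) (Δ := []) (.ax C))
        simpa using this
      simpa using Derivable.ldiv_left h1 h
    · have h1 : Derivable [C, .ldiv C A] C := by
        have := Derivable.ldiv_left (Γ := []) (Δ := []) (.ax C) (hl A (by simp))
        simpa using this
      have h2 := ih hl' (B := B) (by simpa [hA] using hB) h
      simpa using Derivable.rdiv_left h1 h2

theorem dualTp_elim {a : ℕ} {A : Tp} {Γ : List Tp} (h : Derivable Γ A) :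
    Derivable (Γ ++ [.prim 4] ++ [dualTp a A]) (.prim (a + 5)) := by
  have := Derivable.ldiv_left (Γ := []) (Δ := []) (h.mul_right (.ax (.prim 4)))
    (.ax (.prim (a + 5)))
  simpa [dualTp] using this

theorem dualTp_anti {a : ℕ} {A B : Tp} (h : Derivable [A] B) :
    Derivable [dualTp a B] (dualTp a A) := by
  refine .ldiv_right (by simp) ?_
  exact .mul_left (Γ := []) (dualTp_elim h)

theorem derivable_joinTp {s L a : ℕ} {R : List (ℕ × List ℕ)} (hR : ∀ r ∈ R, r.2.length ≤ L)
    {r : ℕ × List ℕ} (hr : r ∈ R) {Γ : List Tp} (h : Derivable Γ (ruleTp s r)) :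
    Derivable Γ (joinTp s L a R) := by
  refine .rdiv_right h.ne_nil ?_
  have h1 : Derivable (Γ ++ [.prim 4] ++ [meetTp (dualTp a (lowTp s L))
      (R.map fun r => dualTp a (ruleTp s r))] ++ []) (.prim (a + 5)) := by
    refine meetTp_left ?_ (Or.inr (List.mem_map.2 ⟨r, hr, rfl⟩)) (by simpa using dualTp_elim h)
    intro B hB
    obtain ⟨r', hr', rfl⟩ := List.mem_map.1 hB
    exact dualTp_anti (lowTp_derivable_ruleTp (hR r' hr'))
  have := Derivable.mul_left (Γ := Γ) (Δ := []) (by simpa using h1)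
  simpa using this

/-- The type of a letter performs every rule that begins with the letter. -/
theorem letterTp_rule {s L a : ℕ} {R : List (ℕ × List ℕ)} (hR : ∀ r ∈ R, r.2.length ≤ L)
    {r : ℕ × List ℕ} (hr : r ∈ R) {Γs : List (List Tp)}
    (h : List.Forall₂ Derivable Γs (r.2.map (ntTp s))) :
    Derivable (letterTp s L a R :: Γs.flatten) (ntTp s r.1) := by
  refine .rdiv_right (by simp) ?_
  have h1 : Derivable (Γs.flatten ++ [contTp (oneHot s r.1)]) (joinTp s L a R) :=
    derivable_joinTp hR hr (.prods_right h (.ax _))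
  have := Derivable.rdiv_left (Γ := []) (Δ := []) h1 (.ax (.prim 0))
  simpa [letterTp] using this

/-- The language generated by a list of nonterminals under the rules `N → a α` in Greibach normal
form, where `R a` lists the pairs `(N, α)`. -/
inductive Greibach (R : ℕ → List (ℕ × List ℕ)) : List ℕ → List ℕ → Prop
  | nil : Greibach R [] []
  | cons {N a : ℕ} {α κ u v : List ℕ} (hr : (N, α) ∈ R a) (hα : Greibach R α u)
      (hκ : Greibach R κ v) : Greibach R (N :: κ) (a :: u ++ v)

theorem Greibach.derivable {s L : ℕ} {R : ℕ → List (ℕ × List ℕ)}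
    (hR : ∀ a, ∀ r ∈ R a, r.2.length ≤ L) {α w : List ℕ} (h : Greibach R α w) :
    ∃ ws : List (List ℕ), ws.flatten = w ∧ List.Forall₂ Derivable
      (ws.map fun u => u.map fun a => letterTp s L a (R a)) (α.map (ntTp s)) := by
  induction h with
  | nil => exact ⟨[], by simp⟩
  | @cons N a α κ u v hr _ _ ihα ihκ =>
    obtain ⟨us, rfl, hus⟩ := ihα
    obtain ⟨vs, rfl, hvs⟩ := ihκ
    refine ⟨(a :: us.flatten) :: vs, by simp, ?_⟩
    have := letterTp_rule (a := a) (hR a) hr hus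
    simp only [List.map_cons, List.forall₂_cons]
    refine ⟨?_, hvs⟩
    simpa [List.map_flatten] using this

/-! ### Language models -/

section Interp
variable {α : Type*}

/-- The language model of the Lambek calculus: a type denotes a language, a product denotes
concatenation, and the divisions denote the residuals among non-empty words. -/
def Tp.interp (val : ℕ → Language α) : Tp → Language α
  | .prim n => val n
  | .mul A B => A.interp val * B.interp val
  | .ldiv A B => {x | x ≠ [] ∧ ∀ y ∈ A.interp val, y ++ x ∈ B.interp val}
  | .rdiv B A => {x | x ≠ [] ∧ ∀ y ∈ A.interp val, x ++ y ∈ B.interp val}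

theorem Tp.mem_interp_mul {val : ℕ → Language α} {A B : Tp} {x : List α} :
    x ∈ (Tp.mul A B).interp val ↔ ∃ y ∈ A.interp val, ∃ z ∈ B.interp val, y ++ z = x := Iff.rfl

theorem Tp.ne_nil_of_mem_interp {val : ℕ → Language α} (hval : ∀ n, [] ∉ val n) {A : Tp}
    {x : List α} (h : x ∈ A.interp val) : x ≠ [] := by
  induction A generalizing x with
  | prim n => rintro rfl; exact hval n h
  | mul A B ihA _ =>
    obtain ⟨y, hy, z, _, rfl⟩ := h
    simp [ihA hy]
  | ldiv A B => exact h.1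
  | rdiv B A => exact h.1

/-- The Lambek calculus is sound for language models. -/
theorem Derivable.sound {val : ℕ → Language α} (hval : ∀ n, [] ∉ val n) {Γ : List Tp} {C : Tp}
    (h : Derivable Γ C) : (Γ.map (Tp.interp val)).prod ≤ C.interp val := by
  have ne : ∀ {Φ : List Tp}, Φ ≠ [] → ∀ x ∈ (Φ.map (Tp.interp val)).prod, x ≠ [] := by
    intro Φ hΦ x hx
    obtain ⟨A, Φ, rfl⟩ := List.exists_cons_of_ne_nil hΦ
    rw [List.map_cons, List.prod_cons] at hx
    obtain ⟨y, hy, z, _, rfl⟩ := hx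
    simp [Tp.ne_nil_of_mem_interp hval hy]
  induction h with
  | ax A => simp
  | ldiv_right hne _ ih =>
    refine fun x hx => ⟨ne hne x hx, fun y hy => ih ?_⟩
    rw [List.map_append, List.prod_append]
    exact ⟨y, by rw [List.map_singleton, List.prod_singleton]; exact hy, x, hx, rfl⟩
  | rdiv_right hne _ ih =>
    refine fun x hx => ⟨ne hne x hx, fun y hy => ih ?_⟩
    rw [List.map_append, List.prod_append]
    exact ⟨x, hx, y, by rw [List.map_singleton, List.prod_singleton]; exact hy, rfl⟩
  | @ldiv_left Γ Φ Δ A B C _ _ ih₁ ih₂ =>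
    refine le_trans ?_ ih₂
    simp only [List.map_append, List.prod_append, List.map_cons, List.map_nil, List.prod_cons,
      List.prod_nil, mul_one]
    refine mul_le_mul_left ?_ _
    rw [mul_assoc]
    refine mul_le_mul_right (?_ : _ ≤ B.interp val) _
    rintro x ⟨y, hy, z, hz, rfl⟩
    exact hz.2 y (ih₁ hy)
  | @rdiv_left Γ Φ Δ A B C _ _ ih₁ ih₂ =>
    refine le_trans ?_ ih₂
    simp only [List.map_append, List.prod_append, List.map_cons, List.map_nil, List.prod_cons,
      List.prod_nil, mul_one]
    refine mul_le_mul_left ?_ _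
    rw [mul_assoc]
    refine mul_le_mul_right (?_ : _ ≤ B.interp val) _
    rintro x ⟨y, hy, z, hz, rfl⟩
    exact hy.2 z (ih₁ hz)
  | mul_right _ _ ih₁ ih₂ =>
    rw [List.map_append, List.prod_append]
    exact mul_le_mul' ih₁ ih₂
  | mul_left _ ih =>
    refine le_trans (le_of_eq ?_) ih
    simp [Tp.interp, mul_assoc]

end Interp

/-! ### The separating model -/

/-- The alphabet of the model that separates derivable from underivable words. -/
inductive ModelSym
  /-- an input letter -/
  | letter (a : ℕ)
  /-- a word of the type `idTp` -/
  | unit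
  /-- the word of the type `prim 1`, up to units on its left -/
  | start
  /-- a slot without a mark -/
  | any
  /-- a slot with a mark -/
  | mark
  /-- the letter that raises the two kinds of slots -/
  | raise
  /-- the word of the type `endTp` -/
  | halt
  /-- the word of the type `prim 4` -/
  | sep
  /-- the letter of the words of the dual types -/
  | pad

/-- Input words may contain units. -/
def ModelSym.IsInput : ModelSym → Prop
  | .letter _ => True
  | .unit => True
  | _ => False

/-- The slots are the letters `any` and `mark`. -/
def ModelSym.IsSlot (c : ModelSym) : Prop := c = .any ∨ c = .mark

/-- The input `u` is accepted before the slots `β`: it contains a unit, or it is empty, or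
some nonterminal whose slot is marked generates it. -/
def Accepts (R : ℕ → List (ℕ × List ℕ)) (u β : List ModelSym) : Prop :=
  .unit ∈ u ∨ u = [] ∨ ∃ q w, β[q]? = some .mark ∧ u = w.map .letter ∧ Greibach R [q] w

/-- The interpretation of the primitive type `prim 0`. -/
def accepted (R : ℕ → List (ℕ × List ℕ)) (s : ℕ) : Language ModelSym :=
  {x | ∃ u β : List ModelSym, x = u ++ .start :: (β ++ [.halt]) ∧ β.length = s ∧
    (∀ c ∈ β, c.IsSlot) ∧ (∀ c ∈ u, c.IsInput) ∧ Accepts R u β}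

/-- The valuation of the primitive types. The one reserved for the letter `a` consists of the
words `y` such that `a y` is accepted, followed by `sep` and any positive number of pads. So
`dualTp a A` contains the rows of pads if `a y` is accepted for all words `y` of `A`. -/
def modelVal (R : ℕ → List (ℕ × List ℕ)) (s : ℕ) : ℕ → Language ModelSym
  | 0 => accepted R s
  | 1 => {x | ∃ n, x = List.replicate n .unit ++ [.start]}
  | 2 => {x | x = [.mark]}
  | 3 => {x | x = [.mark, .raise] ∨ x = [.any, .raise]}
  | 4 => {x | x = [.sep]}
  | a + 5 => {x | ∃ y n, x = y ++ .sep :: List.replicate (n + 1) .pad ∧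
      .letter a :: y ∈ accepted R s}

theorem nil_notMem_modelVal (R : ℕ → List (ℕ × List ℕ)) (s n : ℕ) : [] ∉ modelVal R s n := by
  intro h
  match n, h with
  | 0, ⟨u, β, h, _⟩ => simp at h
  | 1, ⟨n, h⟩ => simp at h
  | 2, h => cases h
  | 3, h => rcases h with h | h <;> cases h
  | 4, h => cases h
  | a + 5, ⟨y, n, h, _⟩ => simp at h

theorem append_cons_inj_of_notMem_left {α : Type*} {a : α} {x₁ x₂ z₁ z₂ : List α} (h₁ : a ∉ x₁)
    (h₂ : a ∉ x₂) (h : x₁ ++ a :: z₁ = x₂ ++ a :: z₂) : x₁ = x₂ ∧ z₁ = z₂ := by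
  induction x₁ generalizing x₂ with
  | nil => cases x₂ <;> simp_all
  | cons c x₁ ih =>
    cases x₂ with
    | nil =>
      rw [List.cons_append, List.nil_append, List.cons.injEq] at h
      exact absurd (h.1 ▸ List.mem_cons_self) h₁
    | cons d x₂ =>
      simp only [List.cons_append, List.cons.injEq] at h
      simp only [List.mem_cons, not_or] at h₁ h₂
      obtain ⟨rfl, rfl⟩ := ih h₁.2 h₂.2 h.2
      simp [h.1]

theorem append_cons_inj_of_notMem_right {α : Type*} {a : α} {x₁ x₂ z₁ z₂ : List α} (h₁ : a ∉ z₁)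
    (h₂ : a ∉ z₂) (h : x₁ ++ a :: z₁ = x₂ ++ a :: z₂) : x₁ = x₂ ∧ z₁ = z₂ := by
  have := append_cons_inj_of_notMem_left (a := a) (x₁ := z₁.reverse) (x₂ := z₂.reverse)
    (z₁ := x₁.reverse) (z₂ := x₂.reverse) (by simpa) (by simpa)
    (by simpa using congrArg List.reverse h)
  simpa [and_comm] using this

section Model
variable {R : ℕ → List (ℕ × List ℕ)} {s : ℕ}

theorem sep_notMem_of_mem_accepted {x : List ModelSym} (h : x ∈ accepted R s) : .sep ∉ x := by
  obtain ⟨u, β, rfl, -, hβ, hu, -⟩ := h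
  intro hx
  simp only [List.mem_append, List.mem_cons, reduceCtorEq, List.not_mem_nil, or_false,
    false_or] at hx
  rcases hx with hx | hx
  · exact hu _ hx
  · rcases hβ _ hx with h | h <;> cases h

theorem mem_interp_anyTp {x : List ModelSym} :
    x ∈ anyTp.interp (modelVal R s) ↔ x = [.mark] ∨ x = [.any] := by
  have hraise : ∀ y : List ModelSym, y ∈ (Tp.ldiv markTp (.prim 3)).interp (modelVal R s) ↔
      y = [.raise] := by
    intro y
    constructor
    · intro h
      have := h.2 [.mark] rfl
      rcases this with h | h <;> simp at h
      exact h
    · rintro rfl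
      refine ⟨by simp, ?_⟩
      rintro z rfl
      exact Or.inl rfl
  constructor
  · intro h
    rcases h.2 [.raise] ((hraise _).2 rfl) with h | h
    · exact Or.inl (List.append_cancel_right (bs := [_]) h)
    · exact Or.inr (List.append_cancel_right (bs := [_]) h)
  · intro h
    refine ⟨by rcases h with rfl | rfl <;> simp, fun y hy => ?_⟩
    obtain rfl := (hraise y).1 hy
    rcases h with rfl | rfl
    · exact Or.inl rfl
    · exact Or.inr rfl

/-- The letters allowed in a slot. -/
def SlotOk (c : Bool) (l : ModelSym) : Prop := l = .mark ∨ c = false ∧ l = .any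

theorem SlotOk.isSlot {c : Bool} {l : ModelSym} (h : SlotOk c l) : l.IsSlot := by
  rcases h with h | h
  · exact Or.inr h
  · exact Or.inl h.2

theorem mem_interp_slotTp {c : Bool} {x : List ModelSym} :
    x ∈ (slotTp c).interp (modelVal R s) ↔ ∃ l, x = [l] ∧ SlotOk c l := by
  cases c
  · rw [show slotTp false = anyTp from rfl, mem_interp_anyTp]
    simp [SlotOk, and_or_left, exists_or]
  · simp only [SlotOk, Bool.true_eq_false, false_and, or_false]
    simp only [exists_eq_right]
    exact Iff.rfl

theorem mem_interp_idTp {x : List ModelSym} :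
    x ∈ idTp.interp (modelVal R s) ↔ ∃ n, x = List.replicate (n + 1) .unit := by
  constructor
  · rintro ⟨hx, h⟩
    obtain ⟨n, hn⟩ := h [.start] ⟨0, rfl⟩
    have := List.append_cancel_right hn
    cases n with
    | zero => exact absurd this hx
    | succ n => exact ⟨n, this⟩
  · rintro ⟨n, rfl⟩
    refine ⟨by simp, ?_⟩
    rintro _ ⟨m, rfl⟩
    exact ⟨n + 1 + m, by rw [← List.append_assoc, List.replicate_append_replicate]⟩

theorem mem_interp_endTp {n : ℕ} {x : List ModelSym} : x ∈ (endTp n).interp (modelVal R s) ↔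
    x ≠ [] ∧ ∀ (k : ℕ) (β : List ModelSym), β.length = n → (∀ c ∈ β, c.IsSlot) →
      List.replicate k .unit ++ .start :: (β ++ x) ∈ accepted R s := by
  induction n generalizing x with
  | zero =>
    refine and_congr_right fun _ => ⟨fun h k β hβ _ => ?_, ?_⟩
    · obtain rfl := List.length_eq_zero_iff.1 hβ
      have := h _ ⟨k, rfl⟩
      rwa [List.append_assoc] at this
    · rintro h _ ⟨k, rfl⟩
      have := h k [] rfl (by simp)
      rwa [List.append_assoc]
  | succ n ih =>
    refine and_congr_right fun hx => ⟨fun h k β hβ hs => ?_, fun h y hy => ?_⟩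
    · obtain ⟨β, c, rfl⟩ : ∃ β' c, β = β' ++ [c] :=
        ⟨_, _, (List.dropLast_append_getLast (by rintro rfl; simp at hβ)).symm⟩
      have hc : [c] ∈ anyTp.interp (modelVal R s) := by
        rw [mem_interp_anyTp]
        rcases hs c (by simp) with rfl | rfl <;> simp
      have := (ih.1 (h _ hc)).2 k β (by simpa using hβ) fun c hc => hs c (by simp [hc])
      simpa using this
    · refine ih.2 ⟨by simp [hx], fun k β hβ hs => ?_⟩
      rw [mem_interp_anyTp] at hy
      rw [← List.append_assoc β]
      refine h k (β ++ y) (by rcases hy with rfl | rfl <;> simp [hβ]) fun c hc => ?_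
      rcases List.mem_append.1 hc with hc | hc
      · exact hs c hc
      · rcases hy with rfl | rfl <;> simp_all [ModelSym.IsSlot]

theorem mem_interp_endTp_self {x : List ModelSym} :
    x ∈ (endTp s).interp (modelVal R s) ↔ x = [.halt] := by
  rw [mem_interp_endTp]
  constructor
  · rintro ⟨-, h⟩
    obtain ⟨u, β, h, hβ, -, hu, -⟩ := h 0 (List.replicate s .any) (by simp)
      (fun c hc => Or.inl (List.eq_of_mem_replicate hc))
    cases u with
    | nil =>
      simp only [List.replicate_zero, List.nil_append, List.cons.injEq, true_and] at h
      exact (List.append_inj h (by simp [hβ])).2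
    | cons c u =>
      simp only [List.replicate_zero, List.nil_append, List.cons_append, List.cons.injEq] at h
      have := hu c (by simp)
      rw [← h.1] at this
      exact this.elim
  · rintro rfl
    refine ⟨by simp, fun k β hβ hs => ⟨_, β, rfl, hβ, hs, ?_, ?_⟩⟩
    · intro c hc
      rw [List.eq_of_mem_replicate hc]
      trivial
    · cases k with
      | zero => exact Or.inr (Or.inl rfl)
      | succ k => exact Or.inl (by simp)

theorem mem_interp_slots {m : List Bool} {B : Tp} {x : List ModelSym} :
    x ∈ (prods (m.map slotTp) B).interp (modelVal R s) ↔
      ∃ β, List.Forall₂ SlotOk m β ∧ ∃ y ∈ B.interp (modelVal R s), β ++ y = x := by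
  induction m generalizing x with
  | nil => simp [prods]
  | cons c m ih =>
    change x ∈ (Tp.mul (slotTp c) (prods (m.map slotTp) B)).interp (modelVal R s) ↔ _
    rw [Tp.mem_interp_mul]
    constructor
    · rintro ⟨_, hl, z, hz, rfl⟩
      obtain ⟨l, rfl, hl'⟩ := mem_interp_slotTp.1 hl
      obtain ⟨β, hβ, y, hy, rfl⟩ := ih.1 hz
      exact ⟨l :: β, .cons hl' hβ, y, hy, rfl⟩
    · rintro ⟨_, hβ, y, hy, rfl⟩
      obtain ⟨l, β, hl, hβ', rfl⟩ := List.forall₂_cons_left_iff.1 hβ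
      exact ⟨[l], mem_interp_slotTp.2 ⟨l, rfl, hl⟩, _, ih.2 ⟨β, hβ', y, hy, rfl⟩, rfl⟩

theorem mem_interp_contTp {m : List Bool} (hm : m.length = s) {x : List ModelSym} :
    x ∈ (contTp m).interp (modelVal R s) ↔ ∃ k β, List.Forall₂ SlotOk m β ∧
      x = List.replicate k .unit ++ .start :: (β ++ [.halt]) := by
  rw [contTp, Tp.mem_interp_mul, hm]
  constructor
  · rintro ⟨_, ⟨k, rfl⟩, y, hy, rfl⟩
    obtain ⟨β, hβ, z, hz, rfl⟩ := mem_interp_slots.1 hy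
    obtain rfl := mem_interp_endTp_self.1 hz
    exact ⟨k, β, hβ, by simp⟩
  · rintro ⟨k, β, hβ, rfl⟩
    exact ⟨_, ⟨k, rfl⟩, _, mem_interp_slots.2 ⟨β, hβ, _, mem_interp_endTp_self.2 rfl, rfl⟩,
      by simp⟩

/-- An input word that contains a unit or is generated by the list `α` of nonterminals. -/
def Generates (R : ℕ → List (ℕ × List ℕ)) (α : List ℕ) (u : List ModelSym) : Prop :=
  (∀ c ∈ u, c.IsInput) ∧ (.unit ∈ u ∨ ∃ w, u = w.map .letter ∧ Greibach R α w)

theorem oneHot_getElem? {s q i : ℕ} (h : i < s) : (oneHot s q)[i]? = some (decide (i = q)) := by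
  simp [oneHot, h]

theorem length_oneHot (s q : ℕ) : (oneHot s q).length = s := by simp [oneHot]

theorem generates_of_mem_interp_ntTp {q : ℕ} {x : List ModelSym}
    (h : x ∈ (ntTp s q).interp (modelVal R s)) : Generates R [q] x := by
  -- The test continuation has no mark besides the one at position `q`.
  set β : List ModelSym := (oneHot s q).map fun c => if c then .mark else .any with hβ
  have hmem : .start :: (β ++ [.halt]) ∈ (contTp (oneHot s q)).interp (modelVal R s) := by
    refine (mem_interp_contTp (length_oneHot s q)).2 ⟨0, β, ?_, rfl⟩
    rw [hβ, List.forall₂_map_right_iff, List.forall₂_same]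
    intro c _
    cases c <;> simp [SlotOk]
  obtain ⟨u, β', he, hl, -, hu, hacc⟩ := h.2 _ hmem
  obtain ⟨rfl, he⟩ := List.append_inj' he (by simp [hβ, hl, length_oneHot])
  obtain rfl : β = β' := by simpa using he
  refine ⟨hu, ?_⟩
  rcases hacc with hacc | hacc | ⟨q', w, hq', rfl, hw⟩
  · exact Or.inl hacc
  · exact absurd hacc h.1
  · have hs : q' < s := by
      have := (List.getElem?_eq_some_iff.1 hq').1
      simpa [hl] using this
    have : q' = q := by
      rw [hβ, List.getElem?_map, oneHot_getElem? hs] at hq'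
      by_contra hne
      simp [hne] at hq'
    subst this
    exact Or.inr ⟨w, rfl, hw⟩

theorem Greibach.append_singleton {q : ℕ} {α u v : List ℕ} (hu : Greibach R [q] u)
    (hv : Greibach R α v) : Greibach R (q :: α) (u ++ v) := by
  cases hu with
  | cons hr hα hκ =>
    cases hκ
    simpa using Greibach.cons hr hα hv

theorem generates_of_mem_interp_prods {α : List ℕ} {B : Tp} {x : List ModelSym}
    (h : x ∈ (prods (α.map (ntTp s)) B).interp (modelVal R s)) :
    ∃ u, Generates R α u ∧ ∃ y ∈ B.interp (modelVal R s), u ++ y = x := by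
  induction α generalizing x with
  | nil => exact ⟨[], ⟨by simp, Or.inr ⟨[], rfl, .nil⟩⟩, x, h, rfl⟩
  | cons q α ih =>
    obtain ⟨u, hu, z, hz, rfl⟩ := h
    obtain ⟨v, hv, y, hy, rfl⟩ := ih hz
    obtain ⟨hu₁, hu₂⟩ := generates_of_mem_interp_ntTp hu
    refine ⟨u ++ v, ⟨?_, ?_⟩, y, hy, by simp⟩
    · intro c hc
      exact (List.mem_append.1 hc).elim (hu₁ c) (hv.1 c)
    · rcases hu₂ with hu₂ | ⟨w, rfl, hw⟩
      · exact Or.inl (by simp [hu₂])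
      rcases hv.2 with hv | ⟨w', rfl, hw'⟩
      · exact Or.inl (by simp [hv])
      · exact Or.inr ⟨w ++ w', by simp, hw.append_singleton hw'⟩

theorem letter_cons_mem_of_mem_ruleTp {a : ℕ} {r : ℕ × List ℕ} (hr : r ∈ R a) (hs : r.1 < s)
    {x : List ModelSym} (h : x ∈ (ruleTp s r).interp (modelVal R s)) :
    .letter a :: x ∈ accepted R s := by
  obtain ⟨u, hu, y, hy, rfl⟩ := generates_of_mem_interp_prods h
  obtain ⟨k, β, hβ, rfl⟩ := (mem_interp_contTp (length_oneHot s r.1)).1 hy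
  refine ⟨.letter a :: (u ++ List.replicate k .unit), β, by simp, ?_, ?_, ?_, ?_⟩
  · rw [← hβ.length_eq, length_oneHot]
  · intro c hc
    obtain ⟨i, hi, rfl⟩ := List.mem_iff_getElem.1 hc
    exact (List.forall₂_iff_get.1 hβ |>.2 i (by rw [hβ.length_eq]; exact hi) hi).isSlot
  · intro c hc
    simp only [List.mem_cons, List.mem_append] at hc
    rcases hc with rfl | hc | hc
    · trivial
    · exact hu.1 c hc
    · rw [List.eq_of_mem_replicate hc]
      trivial
  · cases k with
    | succ k => exact Or.inl (by simp)
    | zero =>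
      rcases hu.2 with hu | ⟨w, rfl, hw⟩
      · exact Or.inl (by simp [hu])
      refine Or.inr (Or.inr ⟨r.1, a :: w, ?_, by simp, ?_⟩)
      · have hl : r.1 < β.length := by rw [← hβ.length_eq, length_oneHot]; exact hs
        have := List.forall₂_iff_get.1 hβ |>.2 r.1 (by rw [length_oneHot]; exact hs) hl
        rw [List.getElem?_eq_getElem hl]
        rcases this with h | ⟨h, -⟩
        · simpa using h
        · simp [oneHot] at h
      · simpa using Greibach.cons (κ := []) hr hw .nil

theorem mem_interp_idTp_prods {n : ℕ} {B : Tp} {x : List ModelSym} :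
    x ∈ (prods (List.replicate n idTp) B).interp (modelVal R s) →
      ∃ k, n ≤ k ∧ ∃ y ∈ B.interp (modelVal R s), x = List.replicate k .unit ++ y := by
  induction n generalizing x with
  | zero => exact fun h => ⟨0, le_rfl, x, h, rfl⟩
  | succ n ih =>
    rintro ⟨u, hu, z, hz, rfl⟩
    obtain ⟨m, rfl⟩ := mem_interp_idTp.1 hu
    obtain ⟨k, hk, y, hy, rfl⟩ := ih hz
    exact ⟨m + 1 + k, by omega, y, hy,
      by simp [← List.replicate_append_replicate, List.append_assoc]⟩

theorem letter_cons_mem_of_mem_lowTp {L a : ℕ} {x : List ModelSym}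
    (h : x ∈ (lowTp s L).interp (modelVal R s)) : .letter a :: x ∈ accepted R s := by
  obtain ⟨k, hk, y, hy, rfl⟩ := mem_interp_idTp_prods h
  obtain ⟨j, β, hβ, rfl⟩ := (mem_interp_contTp (by simp)).1 hy
  refine ⟨.letter a :: (List.replicate k .unit ++ List.replicate j .unit), β,
    by simp only [List.cons_append, List.append_assoc], ?_, ?_, ?_, ?_⟩
  · simpa using hβ.length_eq.symm
  · intro c hc
    obtain ⟨i, hi, rfl⟩ := List.mem_iff_getElem.1 hc
    exact (List.forall₂_iff_get.1 hβ |>.2 i (by rw [hβ.length_eq]; exact hi) hi).isSlot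
  · intro c hc
    simp only [List.mem_cons, List.mem_append] at hc
    rcases hc with rfl | hc | hc
    · trivial
    all_goals
      rw [List.eq_of_mem_replicate hc]
      trivial
  · exact Or.inl (by simp; omega)

theorem exists_mem_interp_lowTp (R : ℕ → List (ℕ × List ℕ)) (s L : ℕ) :
    ∃ x, x ∈ (lowTp s L).interp (modelVal R s) := by
  have h : ∀ n, ∃ x, x ∈ (prods (List.replicate n idTp)
      (contTp (List.replicate s true))).interp (modelVal R s) := by
    intro n
    induction n with
    | zero =>
      refine ⟨_, (mem_interp_contTp (by simp)).2 ⟨0, List.replicate s .mark, ?_, rfl⟩⟩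
      rw [List.forall₂_iff_get]
      refine ⟨by simp, fun i h₁ h₂ => Or.inl (by simp)⟩
    | succ n ih =>
      obtain ⟨x, hx⟩ := ih
      exact ⟨_, _, mem_interp_idTp.2 ⟨0, rfl⟩, x, hx, rfl⟩
  exact h (L + 1)

theorem pad_mem_interp_dualTp {a : ℕ} {A : Tp}
    (h : ∀ x ∈ A.interp (modelVal R s), .letter a :: x ∈ accepted R s) (n : ℕ) :
    List.replicate (n + 1) .pad ∈ (dualTp a A).interp (modelVal R s) := by
  refine ⟨by simp, ?_⟩
  rintro _ ⟨x, hx, _, rfl, rfl⟩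
  exact ⟨x, n, by simp, h x hx⟩

theorem eq_pad_of_mem_interp_dualTp {a : ℕ} {A : Tp} {y : List ModelSym}
    (hy : y ∈ A.interp (modelVal R s)) (hy' : .letter a :: y ∈ accepted R s) {x : List ModelSym}
    (hx : x ∈ (dualTp a A).interp (modelVal R s)) : ∃ n, x = List.replicate (n + 1) .pad := by
  obtain ⟨z, n, he, hz⟩ := hx.2 (y ++ [.sep]) ⟨y, hy, _, rfl, rfl⟩
  have h₁ := sep_notMem_of_mem_accepted hy'
  have h₂ := sep_notMem_of_mem_accepted hz
  simp only [List.mem_cons, not_or] at h₁ h₂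
  exact ⟨n, (append_cons_inj_of_notMem_left h₁.2 h₂.2 (by simpa using he)).2⟩

/-- Each element of `l` adds two factors to `meetTp C l`, which take at least one pad each; this is
why `modelVal` admits any positive number of pads. -/
theorem pad_mem_interp_meetTp {C : Tp} {l : List Tp}
    (hC : ∀ x, x ∈ C.interp (modelVal R s) ↔ ∃ n, x = List.replicate (n + 1) .pad)
    (hl : ∀ B ∈ l, ∀ n, List.replicate (n + 1) .pad ∈ B.interp (modelVal R s)) (n : ℕ) :
    List.replicate (n + 2 * l.length + 1) .pad ∈ (meetTp C l).interp (modelVal R s) := by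
  induction l generalizing n with
  | nil => exact (hC _).2 ⟨n, rfl⟩
  | cons B l ih =>
    refine ⟨List.replicate (n + 2 * l.length + 1) .pad, ⟨by simp, ?_⟩, [.pad, .pad],
      ⟨[.pad], (hC _).2 ⟨0, rfl⟩, [.pad], ⟨by simp, ?_⟩, rfl⟩, ?_⟩
    · rintro y hy
      obtain ⟨m, rfl⟩ := (hC y).1 hy
      have := ih (fun B hB => hl B (by simp [hB])) (n + m + 1)
      rw [List.replicate_append_replicate]
      convert this using 2
      omega
    · rintro y hy
      obtain ⟨m, rfl⟩ := (hC y).1 hy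
      have := hl B (by simp) (m + 1)
      rwa [List.replicate_succ'] at this
    · change List.replicate (n + 2 * l.length + 1) ModelSym.pad ++ List.replicate 2 ModelSym.pad = _
      rw [List.replicate_append_replicate, List.length_cons]
      congr 1

theorem letter_cons_mem_of_mem_joinTp {L a : ℕ} (hs : ∀ r ∈ R a, r.1 < s) {x : List ModelSym}
    (h : x ∈ (joinTp s L a (R a)).interp (modelVal R s)) : .letter a :: x ∈ accepted R s := by
  have hC : ∀ y, y ∈ (dualTp a (lowTp s L)).interp (modelVal R s) ↔
      ∃ n, y = List.replicate (n + 1) .pad := by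
    intro y
    constructor
    · obtain ⟨z, hz⟩ := exists_mem_interp_lowTp R s L
      exact eq_pad_of_mem_interp_dualTp hz (letter_cons_mem_of_mem_lowTp hz)
    · rintro ⟨n, rfl⟩
      exact pad_mem_interp_dualTp (fun x hx => letter_cons_mem_of_mem_lowTp hx) n
  have hm := pad_mem_interp_meetTp (l := (R a).map fun r => dualTp a (ruleTp s r)) hC (by
    intro B hB n
    obtain ⟨r, hr, rfl⟩ := List.mem_map.1 hB
    exact pad_mem_interp_dualTp (fun x hx => letter_cons_mem_of_mem_ruleTp hr (hs r hr) hx) n) 0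
  obtain ⟨y, n, he, hy⟩ := h.2 _ ⟨[.sep], rfl, _, hm, rfl⟩
  obtain ⟨rfl, -⟩ := append_cons_inj_of_notMem_right (a := ModelSym.sep)
    (by intro h; cases List.eq_of_mem_replicate h) (by intro h; cases List.eq_of_mem_replicate h) he
  exact hy

theorem letter_mem_interp_letterTp {L a : ℕ} (hs : ∀ r ∈ R a, r.1 < s) :
    [.letter a] ∈ (letterTp s L a (R a)).interp (modelVal R s) :=
  ⟨by simp, fun _ hy => letter_cons_mem_of_mem_joinTp hs hy⟩

end Model

/-- A letter belongs to the interpretation of its own type, and the interpretation of `ntTp s q`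
contains no words of letters but the ones generated by `q`. Hence these types realize a grammar in
Greibach normal form. -/
theorem derivable_letterTp_iff {R : ℕ → List (ℕ × List ℕ)} {s L : ℕ}
    (hs : ∀ a, ∀ r ∈ R a, r.1 < s) (hL : ∀ a, ∀ r ∈ R a, r.2.length ≤ L) (q : ℕ) (w : List ℕ) :
    Derivable (w.map fun a => letterTp s L a (R a)) (ntTp s q) ↔ Greibach R [q] w := by
  constructor
  · intro h
    have hmem : ∀ w : List ℕ, w.map ModelSym.letter ∈
        ((w.map fun a => letterTp s L a (R a)).map (Tp.interp (modelVal R s))).prod := by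
      intro w
      induction w with
      | nil => rfl
      | cons a w ih => exact ⟨_, letter_mem_interp_letterTp (hs a), _, ih, rfl⟩
    obtain ⟨-, hu | ⟨w', hw', h'⟩⟩ := generates_of_mem_interp_ntTp
      (h.sound (nil_notMem_modelVal R s) (hmem w))
    · simp at hu
    · obtain rfl := List.map_injective_iff.2 (fun _ _ h => by cases h; rfl) hw'
      exact h'
  · intro h
    obtain ⟨ws, rfl, hws⟩ := h.derivable (s := s) hL
    match ws, hws with
    | [u], hws => simpa using hws

/-! ### Context-free derivations -/

section Gen
variable {T N : Type*}

/-- The words generated by a list of symbols under a list of context-free rules. -/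
inductive Gen (R : List (N × List (T ⊕ N))) : List (T ⊕ N) → List T → Prop
  | nil : Gen R [] []
  | letter {a : T} {β : List (T ⊕ N)} {w : List T} (h : Gen R β w) : Gen R (.inl a :: β) (a :: w)
  | rule {B : N} {γ β : List (T ⊕ N)} {u v : List T} (hr : (B, γ) ∈ R) (hγ : Gen R γ u)
      (hβ : Gen R β v) : Gen R (.inr B :: β) (u ++ v)

variable {R : List (N × List (T ⊕ N))}

theorem Gen.append {β γ : List (T ⊕ N)} {u v : List T} (hβ : Gen R β u) (hγ : Gen R γ v) :
    Gen R (β ++ γ) (u ++ v) := by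
  induction hβ with
  | nil => exact hγ
  | letter _ ih => exact .letter ih
  | rule hr hγ' _ _ ih => simpa using Gen.rule hr hγ' ih

theorem gen_append_iff {β γ : List (T ⊕ N)} {w : List T} :
    Gen R (β ++ γ) w ↔ ∃ u v, u ++ v = w ∧ Gen R β u ∧ Gen R γ v := by
  constructor
  · intro h
    induction β generalizing w with
    | nil => exact ⟨[], w, rfl, .nil, h⟩
    | cons c β ih =>
      cases h with
      | letter h =>
        obtain ⟨u, v, rfl, hu, hv⟩ := ih h
        exact ⟨_, v, rfl, hu.letter, hv⟩
      | rule hr hγ h =>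
        obtain ⟨u, v, rfl, hu, hv⟩ := ih h
        exact ⟨_, v, by simp, Gen.rule hr hγ hu, hv⟩
  · rintro ⟨u, v, rfl, hu, hv⟩
    exact hu.append hv

theorem gen_cons_iff {c : T ⊕ N} {γ : List (T ⊕ N)} {w : List T} :
    Gen R (c :: γ) w ↔ ∃ u v, u ++ v = w ∧ Gen R [c] u ∧ Gen R γ v :=
  gen_append_iff (β := [c])

theorem gen_nonterminal_iff {B : N} {w : List T} :
    Gen R [.inr B] w ↔ ∃ γ, (B, γ) ∈ R ∧ Gen R γ w := by
  constructor
  · intro h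
    cases h with
    | rule hr hγ hβ =>
      cases hβ
      exact ⟨_, hr, by simpa using hγ⟩
  · rintro ⟨γ, hr, hγ⟩
    simpa using Gen.rule hr hγ .nil

/-- A terminal or nonterminal symbol as an element of a sum type. -/
def symbolToSum : Symbol T N → T ⊕ N
  | .terminal a => .inl a
  | .nonterminal B => .inr B

theorem mem_language_iff_gen {g : ContextFreeGrammar T} {R : List (g.NT × List (T ⊕ g.NT))}
    (hR : ∀ x, x ∈ R ↔ ∃ r ∈ g.rules, (r.input, r.output.map symbolToSum) = x) (w : List T) :
    w ∈ g.language ↔ Gen R [.inr g.initial] w := by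
  constructor
  · intro h
    suffices ∀ u, g.Derives u (w.map .terminal) → Gen R (u.map symbolToSum) w from this _ h
    intro u hu
    induction hu using Relation.ReflTransGen.head_induction_on with
    | refl =>
      clear h
      induction w with
      | nil => exact .nil
      | cons a w ih => exact .letter ih
    | head h _ ih =>
      obtain ⟨r, hr, h⟩ := h
      obtain ⟨p, q, rfl, rfl⟩ := h.exists_parts
      rw [List.map_append, List.map_append, gen_append_iff] at ih ⊢
      obtain ⟨u, v, rfl, hu, hv⟩ := ih
      rw [gen_append_iff] at hu
      obtain ⟨u₁, u₂, rfl, hu₁, hu₂⟩ := hu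
      refine ⟨_, v, rfl, ?_, hv⟩
      exact hu₁.append (gen_nonterminal_iff.2 ⟨_, (hR _).2 ⟨r, hr, rfl⟩, hu₂⟩)
  · intro h
    suffices ∀ β w, Gen R β w → ∀ u : List (Symbol T g.NT), u.map symbolToSum = β →
        g.Derives u (w.map .terminal) from this _ _ h _ rfl
    intro β w h
    induction h with
    | nil =>
      intro u hu
      rw [List.map_eq_nil_iff] at hu
      subst hu
      exact .refl _
    | @letter a β w _ ih =>
      intro u hu
      obtain ⟨c, u, rfl, hc, rfl⟩ := List.map_eq_cons_iff.1 hu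
      cases c with
      | terminal a' =>
        cases hc
        exact (ih u rfl).append_left [.terminal _]
      | nonterminal B => cases hc
    | @rule B γ β x y hr _ _ ihγ ihβ =>
      intro u hu
      obtain ⟨c, u, rfl, hc, rfl⟩ := List.map_eq_cons_iff.1 hu
      cases c with
      | terminal a => cases hc
      | nonterminal B' =>
        cases hc
        obtain ⟨r, hr', he⟩ := (hR _).1 hr
        cases he
        have h1 : g.Produces ([.nonterminal r.input] ++ u) (r.output ++ u) :=
          ContextFreeGrammar.Produces.append_right ⟨r, hr', ContextFreeRule.Rewrites.input_output⟩ u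
        have h2 := (ihγ r.output rfl).append_right u
        have h3 := (ihβ u rfl).append_left (x.map .terminal)
        rw [List.map_append]
        exact h1.trans_derives (h2.trans h3)

end Gen

/-! ### Left-corner transformation to Greibach normal form -/

/-- The nonterminals of the left-corner grammar: `lcNT Y none` generates what `Y` generates, and
`lcNT Y (some X)` generates the non-empty words that complete an initial `X` to a `Y`. -/
def lcNT (Y : ℕ ⊕ ℕ) (o : Option (ℕ ⊕ ℕ)) : ℕ := Encodable.encode (Y, o)

/-- The pairs of the right-hand side and the left-hand side of the unit rules. -/
def unitEdges (R : List (ℕ × List (ℕ ⊕ ℕ))) : List ((ℕ ⊕ ℕ) × (ℕ ⊕ ℕ)) :=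
  R.flatMap fun r => if r.2.length = 1 then r.2.map fun c => (c, .inr r.1) else []

/-- One round of Warshall's algorithm: add the composite edges through the node `k`. -/
def addThrough (k : ℕ ⊕ ℕ) (E : List ((ℕ ⊕ ℕ) × (ℕ ⊕ ℕ))) : List ((ℕ ⊕ ℕ) × (ℕ ⊕ ℕ)) :=
  E ++ E.flatMap fun p => E.flatMap fun q => if p.2 = k ∧ q.1 = k then [(p.1, q.2)] else []

/-- The transitive closure of the unit rules. -/
def unitClosure (R : List (ℕ × List (ℕ ⊕ ℕ))) : List ((ℕ ⊕ ℕ) × (ℕ ⊕ ℕ)) :=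
  (R.map fun r => .inr r.1).foldr addThrough (unitEdges R)

/-- `Y` derives `X` by unit rules alone. -/
def UnitLE (R : List (ℕ × List (ℕ ⊕ ℕ))) (X Y : ℕ ⊕ ℕ) : Prop := X = Y ∨ (X, Y) ∈ unitClosure R

instance (R : List (ℕ × List (ℕ ⊕ ℕ))) (X Y : ℕ ⊕ ℕ) : Decidable (UnitLE R X Y) :=
  @instDecidableOr _ _ inferInstance
    (@List.instDecidableMemOfLawfulBEq _ instBEqOfDecidableEq inferInstance _ _)

/-- The ways to complete an initial `X` to a `Y`: by nothing, if unit rules suffice, or by a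
non-empty word. -/
def completions (R : List (ℕ × List (ℕ ⊕ ℕ))) (Y X : ℕ ⊕ ℕ) : List (List ℕ) :=
  (if UnitLE R X Y then [[]] else []) ++ [[lcNT Y (some X)]]

/-- The symbols of a grammar with initial nonterminal `S` and rules `R`. -/
def symbols (S : ℕ) (R : List (ℕ × List (ℕ ⊕ ℕ))) : List (ℕ ⊕ ℕ) :=
  .inr S :: R.flatMap fun r => .inr r.1 :: r.2

/-- The rules that find the letter `b` as the left corner of `c`. -/
def goalRules (S : ℕ) (R : List (ℕ × List (ℕ ⊕ ℕ))) (b : ℕ) : List (ℕ × List ℕ) :=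
  (symbols S R).flatMap fun c => (completions R c (.inl b)).map fun o => (lcNT c none, o)

/-- The rules that go on from `X` towards `Y` by the rule `r`, whose right-hand side begins with
`X'` and `c`: the next letter `b` is the left corner of `c`. -/
def stepRules (R : List (ℕ × List (ℕ ⊕ ℕ))) (b : ℕ) (Y X : ℕ ⊕ ℕ) (r : ℕ × List (ℕ ⊕ ℕ))
    (X' c : ℕ ⊕ ℕ) : List (ℕ × List ℕ) :=
  if UnitLE R X X' then
    (completions R c (.inl b)).flatMap fun o₁ => (completions R Y (.inr r.1)).map fun o₂ =>
      (lcNT Y (some X), o₁ ++ (r.2.drop 2).map (fun d => lcNT d none) ++ o₂)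
  else []

/-- The rules of the left-corner grammar that begin with the letter `b`. -/
def lcRules (S : ℕ) (R : List (ℕ × List (ℕ ⊕ ℕ))) (b : ℕ) : List (ℕ × List ℕ) :=
  goalRules S R b ++
  (symbols S R).flatMap fun Y => (symbols S R).flatMap fun X => R.flatMap fun r =>
    r.2[0]?.toList.flatMap fun X' => r.2[1]?.toList.flatMap fun c => stepRules R b Y X r X' c

theorem lcNT_inj {Y Y' : ℕ ⊕ ℕ} {o o' : Option (ℕ ⊕ ℕ)} :
    lcNT Y o = lcNT Y' o' ↔ Y = Y' ∧ o = o' := by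
  simp [lcNT, Encodable.encode_inj]

section LC
variable {S : ℕ} {R : List (ℕ × List (ℕ ⊕ ℕ))}

theorem mem_addThrough {k X Y : ℕ ⊕ ℕ} {E : List ((ℕ ⊕ ℕ) × (ℕ ⊕ ℕ))} :
    (X, Y) ∈ addThrough k E ↔ (X, Y) ∈ E ∨ (X, k) ∈ E ∧ (k, Y) ∈ E := by
  simp only [addThrough, List.mem_append, List.mem_flatMap, Prod.exists, List.mem_ite_nil_right,
    List.mem_singleton, Prod.mk.injEq]
  constructor
  · rintro (h | ⟨_, _, h1, _, _, h2, ⟨rfl, rfl⟩, rfl, rfl⟩)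
    · exact Or.inl h
    · exact Or.inr ⟨h1, h2⟩
  · rintro (h | ⟨h1, h2⟩)
    · exact Or.inl h
    · exact Or.inr ⟨_, _, h1, _, _, h2, ⟨rfl, rfl⟩, rfl, rfl⟩

/-- Warshall's algorithm: the result is transitive at the nodes that were processed. -/
theorem foldr_addThrough_trans {ks : List (ℕ ⊕ ℕ)} {E : List ((ℕ ⊕ ℕ) × (ℕ ⊕ ℕ))} {m : ℕ ⊕ ℕ}
    (hm : m ∈ ks) {X Y : ℕ ⊕ ℕ} (hX : (X, m) ∈ ks.foldr addThrough E)
    (hY : (m, Y) ∈ ks.foldr addThrough E) : (X, Y) ∈ ks.foldr addThrough E := by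
  induction ks generalizing X Y with
  | nil => simp at hm
  | cons k ks ih =>
    rw [List.foldr_cons, mem_addThrough] at *
    by_cases hk : m = k
    · subst hk
      tauto
    · have hm : m ∈ ks := by simpa [hk] using hm
      have ih := @ih hm
      rcases hX with hX | ⟨hX, hX'⟩ <;> rcases hY with hY | ⟨hY, hY'⟩
      · exact Or.inl (ih hX hY)
      · exact Or.inr ⟨ih hX hY, hY'⟩
      · exact Or.inr ⟨hX, ih hX' hY⟩
      · exact Or.inr ⟨hX, hY'⟩

theorem mem_unitEdges {X Y : ℕ ⊕ ℕ} :
    (X, Y) ∈ unitEdges R ↔ ∃ B, Y = .inr B ∧ (B, [X]) ∈ R := by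
  simp only [unitEdges, List.mem_flatMap, Prod.exists, List.mem_ite_nil_right, List.mem_map,
    Prod.mk.injEq]
  constructor
  · rintro ⟨B, γ, hr, hl, c, hc, rfl, rfl⟩
    obtain ⟨d, rfl⟩ := List.length_eq_one_iff.1 hl
    obtain rfl := List.mem_singleton.1 hc
    exact ⟨B, rfl, hr⟩
  · rintro ⟨B, rfl, hr⟩
    exact ⟨B, [X], hr, rfl, X, by simp, rfl, rfl⟩

theorem unitLE_of_rule {B : ℕ} {X Y : ℕ ⊕ ℕ} (hr : (B, [X]) ∈ R) (h : UnitLE R (.inr B) Y) :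
    UnitLE R X Y := by
  have h1 : (X, Sum.inr B) ∈ unitClosure R := by
    have h : (X, Sum.inr B) ∈ unitEdges R := mem_unitEdges.2 ⟨B, rfl, hr⟩
    unfold unitClosure
    generalize R.map (fun r => (Sum.inr r.1 : ℕ ⊕ ℕ)) = ks
    induction ks with
    | nil => exact h
    | cons k ks ih => exact mem_addThrough.2 (Or.inl ih)
  rcases h with rfl | h
  · exact Or.inr h1
  · exact Or.inr (foldr_addThrough_trans (List.mem_map.2 ⟨_, hr, rfl⟩) h1 h)

theorem UnitLE.gen {X Y : ℕ ⊕ ℕ} (h : UnitLE R X Y) {w : List ℕ} (hw : Gen R [X] w) :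
    Gen R [Y] w := by
  rcases h with rfl | h
  · exact hw
  unfold unitClosure at h
  generalize R.map (fun r => (Sum.inr r.1 : ℕ ⊕ ℕ)) = ks at h
  induction ks generalizing X Y w with
  | nil =>
    obtain ⟨B, rfl, hr⟩ := mem_unitEdges.1 h
    exact gen_nonterminal_iff.2 ⟨_, hr, hw⟩
  | cons k ks ih =>
    rcases mem_addThrough.1 h with h | ⟨h1, h2⟩
    · exact ih hw h
    · exact ih (ih hw h1) h2

theorem mem_completions {X Y : ℕ ⊕ ℕ} {o : List ℕ} :
    o ∈ completions R Y X ↔ UnitLE R X Y ∧ o = [] ∨ o = [lcNT Y (some X)] := by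
  simp [completions]

theorem mem_lcRules {b : ℕ} {p : ℕ × List ℕ} : p ∈ lcRules S R b ↔
    (∃ c ∈ symbols S R, ∃ o ∈ completions R c (.inl b), p = (lcNT c none, o)) ∨
    ∃ Y ∈ symbols S R, ∃ X ∈ symbols S R, ∃ B X' c β, (B, X' :: c :: β) ∈ R ∧ UnitLE R X X' ∧
      ∃ o₁ ∈ completions R c (.inl b), ∃ o₂ ∈ completions R Y (.inr B),
        p = (lcNT Y (some X), o₁ ++ β.map (fun d => lcNT d none) ++ o₂) := by
  simp only [lcRules, goalRules, stepRules, List.mem_append, List.mem_flatMap, List.mem_map,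
    List.mem_ite_nil_right, Option.mem_toList, eq_comm (a := p)]
  refine or_congr Iff.rfl (exists_congr fun Y => and_congr_right fun _ => exists_congr fun X =>
    and_congr_right fun _ => ?_)
  constructor
  · rintro ⟨⟨B, γ⟩, hr, X', hX', c, hc, hu, o₁, ho₁, o₂, ho₂, he⟩
    match γ, hX', hc with
    | X' :: c :: β, rfl, rfl => exact ⟨B, X', c, β, hr, hu, o₁, ho₁, o₂, ho₂, he⟩
  · rintro ⟨B, X', c, β, hr, hu, o₁, ho₁, o₂, ho₂, he⟩
    exact ⟨_, hr, X', rfl, c, rfl, hu, o₁, ho₁, o₂, ho₂, he⟩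

/-- The intended language of a nonterminal of the left-corner grammar. -/
def lcLanguage (R : List (ℕ × List (ℕ ⊕ ℕ))) (n : ℕ) : Language ℕ :=
  {w | (∀ c, n = lcNT c none → Gen R [c] w) ∧
    ∀ Y X, n = lcNT Y (some X) → ∀ v, Gen R [X] v → Gen R [Y] (v ++ w)}

theorem gen_of_mem_completions {X Y : ℕ ⊕ ℕ} {o : List ℕ} (ho : o ∈ completions R Y X)
    {v w : List ℕ} (hw : w ∈ (o.map (lcLanguage R)).prod) (hv : Gen R [X] v) :
    Gen R [Y] (v ++ w) := by
  rcases mem_completions.1 ho with ⟨hu, rfl⟩ | rfl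
  · obtain rfl : w = [] := hw
    simpa using hu.gen hv
  · rw [List.map_singleton, List.prod_singleton] at hw
    exact hw.2 _ _ rfl v hv

theorem gen_of_mem_goals {β : List (ℕ ⊕ ℕ)} {w : List ℕ}
    (hw : w ∈ ((β.map fun d => lcNT d none).map (lcLanguage R)).prod) : Gen R β w := by
  induction β generalizing w with
  | nil =>
    obtain rfl : w = [] := hw
    exact .nil
  | cons d β ih =>
    rw [List.map_cons, List.map_cons, List.prod_cons] at hw
    obtain ⟨u, hu, v, hv, rfl⟩ := hw
    exact gen_cons_iff.2 ⟨u, v, rfl, hu.1 _ rfl, ih hv⟩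

theorem Greibach.mem_lcLanguage {κ w : List ℕ} (h : Greibach (lcRules S R) κ w) :
    w ∈ (κ.map (lcLanguage R)).prod := by
  induction h with
  | nil => rfl
  | @cons N b α κ u v hr _ _ ihα ihκ =>
    rw [List.map_cons, List.prod_cons]
    refine ⟨b :: u, ?_, v, ihκ, rfl⟩
    have hb : Gen R [.inl b] [b] := .letter .nil
    rcases mem_lcRules.1 hr with ⟨c, -, o, ho, he⟩ |
      ⟨Y, -, X, -, B, X', c, β, hB, hu, o₁, ho₁, o₂, ho₂, he⟩
    · obtain ⟨rfl, rfl⟩ := Prod.mk.inj he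
      refine ⟨fun c' hc' => ?_, fun Y X h => by simp [lcNT_inj] at h⟩
      obtain ⟨rfl, -⟩ := lcNT_inj.1 hc'
      exact gen_of_mem_completions ho ihα hb
    · obtain ⟨rfl, rfl⟩ := Prod.mk.inj he
      refine ⟨fun c h => by simp [lcNT_inj] at h, fun Y' X₁ h x hx => ?_⟩
      obtain ⟨rfl, h'⟩ := lcNT_inj.1 h
      obtain rfl := Option.some.inj h'
      rw [List.map_append, List.map_append, List.prod_append, List.prod_append] at ihα
      obtain ⟨_, ⟨u₁, hu₁, u₂, hu₂, rfl⟩, u₃, hu₃, rfl⟩ := ihα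
      have h1 : Gen R (X' :: c :: β) (x ++ ((b :: u₁) ++ u₂)) :=
        gen_cons_iff.2 ⟨_, _, rfl, hu.gen hx, gen_cons_iff.2 ⟨_, _, rfl,
          gen_of_mem_completions ho₁ hu₁ hb, gen_of_mem_goals hu₂⟩⟩
      have h2 := gen_of_mem_completions ho₂ hu₃ (gen_nonterminal_iff.2 ⟨_, hB, h1⟩)
      simpa using h2

theorem Greibach.append {G : ℕ → List (ℕ × List ℕ)} {κ κ' u v : List ℕ} (hu : Greibach G κ u)
    (hv : Greibach G κ' v) : Greibach G (κ ++ κ') (u ++ v) := by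
  induction hu with
  | nil => exact hv
  | cons hr hα _ _ ih => simpa using Greibach.cons hr hα ih

/-- The left-corner grammar completes an initial `X` to a `Y` by the word `v`. -/
def Completes (S : ℕ) (R : List (ℕ × List (ℕ ⊕ ℕ))) (Y X : ℕ ⊕ ℕ) (v : List ℕ) : Prop :=
  ∃ o ∈ completions R Y X, Greibach (lcRules S R) o v

theorem completes_self (Y : ℕ ⊕ ℕ) : Completes S R Y Y [] :=
  ⟨[], mem_completions.2 (Or.inl ⟨Or.inl rfl, rfl⟩), .nil⟩

theorem Completes.of_unit_rule {B : ℕ} {X Y : ℕ ⊕ ℕ} {v : List ℕ} (hr : (B, [X]) ∈ R)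
    (hX : X ∈ symbols S R) (h : Completes S R Y (.inr B) v) : Completes S R Y X v := by
  obtain ⟨o, ho, hv⟩ := h
  rcases mem_completions.1 ho with ⟨hu, rfl⟩ | rfl
  · exact ⟨[], mem_completions.2 (Or.inl ⟨unitLE_of_rule hr hu, rfl⟩), hv⟩
  · refine ⟨_, mem_completions.2 (Or.inr rfl), ?_⟩
    cases hv with
    | cons hp hα hκ =>
      rcases mem_lcRules.1 hp with ⟨c, -, o, -, he⟩ |
        ⟨Y', hY, X₁, -, B', X', c, β, hB', hu, o₁, ho₁, o₂, ho₂, he⟩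
      · simp [lcNT_inj] at he
      · obtain ⟨hN, rfl⟩ := Prod.mk.inj he
        obtain ⟨rfl, hX'⟩ := lcNT_inj.1 hN
        obtain rfl := Option.some.inj hX'
        exact .cons (mem_lcRules.2 (Or.inr ⟨Y, hY, X, hX, B', X', c, β, hB',
          unitLE_of_rule hr hu, o₁, ho₁, o₂, ho₂, rfl⟩)) hα hκ

/-- The word `w` of the symbol `c` starts with a letter from which the left-corner grammar finds
the rest of `w` on the way from `c` to any goal `Y`. -/
def HasCorner (S : ℕ) (R : List (ℕ × List (ℕ ⊕ ℕ))) (c : ℕ ⊕ ℕ) (w : List ℕ) : Prop :=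
  ∃ b u, w = b :: u ∧ ∀ Y ∈ symbols S R, ∀ v, Completes S R Y c v →
    Completes S R Y (.inl b) (u ++ v)

theorem HasCorner.greibach {c : ℕ ⊕ ℕ} (hc : c ∈ symbols S R) {w : List ℕ}
    (h : HasCorner S R c w) : Greibach (lcRules S R) [lcNT c none] w := by
  obtain ⟨b, u, rfl, h⟩ := h
  obtain ⟨o, ho, hu⟩ := h c hc [] (completes_self c)
  have := Greibach.cons (R := lcRules S R) (κ := [])
    (mem_lcRules.2 (Or.inl ⟨c, hc, o, ho, rfl⟩)) hu .nil
  simpa using this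

theorem greibach_goals {β : List (ℕ ⊕ ℕ)} (hβ : ∀ c ∈ β, c ∈ symbols S R) {ws : List (List ℕ)}
    (h : List.Forall₂ (HasCorner S R) β ws) :
    Greibach (lcRules S R) (β.map fun d => lcNT d none) ws.flatten := by
  induction h with
  | nil => exact .nil
  | @cons d w β ws hd _ ih =>
    exact (hd.greibach (hβ d (by simp))).append (ih fun c hc => hβ c (by simp [hc]))

theorem mem_symbols_of_rule {B : ℕ} {γ : List (ℕ ⊕ ℕ)} (hr : (B, γ) ∈ R) {c : ℕ ⊕ ℕ}
    (hc : c ∈ γ) : c ∈ symbols S R := by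
  simp only [symbols, List.mem_cons, List.mem_flatMap]
  exact Or.inr ⟨_, hr, Or.inr hc⟩

theorem HasCorner.rule {B : ℕ} {γ : List (ℕ ⊕ ℕ)} (hr : (B, γ) ∈ R) (hγ : γ ≠ [])
    {ws : List (List ℕ)} (h : List.Forall₂ (HasCorner S R) γ ws) :
    HasCorner S R (.inr B) ws.flatten := by
  cases h with
  | nil => exact absurd rfl hγ
  | @cons X w β ws hX hβ =>
    have hmem : ∀ c ∈ X :: β, c ∈ symbols S R := fun c hc => mem_symbols_of_rule hr hc
    obtain ⟨b, u, rfl, h⟩ := hX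
    refine ⟨b, u ++ ws.flatten, by simp, fun Y hY v hv => ?_⟩
    rw [List.append_assoc]
    refine h Y hY _ ?_
    cases hβ with
    | nil => simpa using hv.of_unit_rule hr (hmem X (by simp))
    | @cons c w β ws hc hβ =>
      obtain ⟨b', u', rfl, h'⟩ := hc
      obtain ⟨o₁, ho₁, hu'⟩ := h' c (hmem c (by simp)) [] (completes_self c)
      obtain ⟨o₂, ho₂, hv⟩ := hv
      have hg := greibach_goals (fun d hd => hmem d (by simp [hd])) hβ
      refine ⟨_, mem_completions.2 (Or.inr rfl), ?_⟩
      have := Greibach.cons (R := lcRules S R) (κ := []) (mem_lcRules.2 (Or.inr ⟨Y, hY, X,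
        hmem X (by simp), B, X, c, β, hr, Or.inl rfl, o₁, ho₁, o₂, ho₂, rfl⟩))
        ((hu'.append hg).append hv) .nil
      simpa using this

theorem Gen.hasCorner (hR : ∀ r ∈ R, r.2 ≠ []) {β : List (ℕ ⊕ ℕ)} {w : List ℕ} (h : Gen R β w) :
    ∃ ws, List.flatten ws = w ∧ List.Forall₂ (HasCorner S R) β ws := by
  induction h with
  | nil => exact ⟨[], rfl, .nil⟩
  | @letter a β w _ ih =>
    obtain ⟨ws, rfl, h⟩ := ih
    exact ⟨[a] :: ws, rfl, .cons ⟨a, [], rfl, fun _ _ _ hv => hv⟩ h⟩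
  | rule hr _ _ ihγ ihβ =>
    obtain ⟨us, rfl, hu⟩ := ihγ
    obtain ⟨vs, rfl, hv⟩ := ihβ
    exact ⟨us.flatten :: vs, rfl, .cons (HasCorner.rule hr (hR _ hr) hu) hv⟩

/-- The left-corner grammar generates the language of the given grammar. -/
theorem greibach_lcRules_iff (hR : ∀ r ∈ R, r.2 ≠ []) (w : List ℕ) :
    Greibach (lcRules S R) [lcNT (.inr S) none] w ↔ Gen R [.inr S] w := by
  constructor
  · intro h
    have := h.mem_lcLanguage
    rw [List.map_singleton, List.prod_singleton] at this
    exact this.1 _ rfl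
  · intro h
    obtain ⟨ws, rfl, hws⟩ := h.hasCorner (S := S) hR
    cases hws with
    | cons hc hnil =>
      cases hnil
      simpa using hc.greibach (by simp [symbols])

end LC

/-! ### Computability of the construction -/

section Computability

/-- All rules of the left-corner grammar. -/
def allRules (G : CFGData) : List (ℕ × List ℕ) :=
  (List.range G.numTerminals).flatMap (lcRules G.initial G.rules)

/-- A strict upper bound of the nonterminals of the left-corner grammar. -/
def ntBound (G : CFGData) : ℕ := (allRules G).foldr (fun r m => r.1 + 1 + m) 0

/-- An upper bound of the number of nonterminals in the right-hand side of a rule of the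
left-corner grammar. -/
def lengthBound (G : CFGData) : ℕ := (allRules G).foldr (fun r m => r.2.length + m) 0

/-- The type of the letter `a` in the Lambek grammar for `G`. -/
def assignTp (G : CFGData) (a : ℕ) : Tp :=
  letterTp (ntBound G) (lengthBound G) a (lcRules G.initial G.rules a)

/-- The target type of the Lambek grammar for `G`. -/
def targetTp (G : CFGData) : Tp := ntTp (ntBound G) (lcNT (.inr G.initial) none)

/-- The Lambek grammar for `G`: the types of the letters, and the target type. -/
def lambekGrammar (G : CFGData) : List Tp × Tp :=
  ((List.range G.numTerminals).map (assignTp G), targetTp G)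

open Primrec

theorem primrec_prim : Primrec Tp.prim :=
  (of_equiv_iff Tp.equivNat).1 (nat_mul.comp (.const 4) .id)

theorem primrec_code : Primrec Tp.code := of_equiv (e := Tp.equivNat)

theorem primrec_mul : Primrec₂ Tp.mul :=
  (of_equiv_iff Tp.equivNat).1 <| nat_add.comp (nat_mul.comp (.const 4)
    (Primrec₂.natPair.comp (primrec_code.comp .fst) (primrec_code.comp .snd))) (.const 1)

theorem primrec_ldiv : Primrec₂ Tp.ldiv :=
  (of_equiv_iff Tp.equivNat).1 <| nat_add.comp (nat_mul.comp (.const 4)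
    (Primrec₂.natPair.comp (primrec_code.comp .fst) (primrec_code.comp .snd))) (.const 2)

theorem primrec_rdiv : Primrec₂ Tp.rdiv :=
  (of_equiv_iff Tp.equivNat).1 <| nat_add.comp (nat_mul.comp (.const 4)
    (Primrec₂.natPair.comp (primrec_code.comp .fst) (primrec_code.comp .snd))) (.const 3)

theorem primrec_prods : Primrec₂ prods :=
  list_foldr .fst .snd (primrec_mul.comp (fst.comp .snd) (snd.comp .snd)).to₂

theorem primrec_endTp : Primrec endTp :=
  (nat_rec' .id (.const (Tp.ldiv (.prim 1) (.prim 0)))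
    (primrec_ldiv.comp (.const anyTp) (snd.comp .snd)).to₂).of_eq fun n => by
      induction n with
      | zero => rfl
      | succ n ih => exact congrArg (Tp.ldiv anyTp) ih

theorem primrec_contTp : Primrec contTp :=
  primrec_mul.comp (.const _) <| primrec_prods.comp
    (list_map .id ((Primrec.dom_finite slotTp).comp .snd).to₂)
    (primrec_endTp.comp list_length)

theorem primrec_oneHot : Primrec₂ oneHot :=
  list_map (list_range.comp .fst)
    (PrimrecPred.decide (Primrec.eq.comp .snd (snd.comp .fst))).to₂

theorem primrec_ntTp : Primrec₂ ntTp :=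
  primrec_rdiv.comp (.const _) (primrec_contTp.comp primrec_oneHot)

theorem primrec_ruleTp : Primrec₂ ruleTp :=
  primrec_prods.comp
    (list_map (snd.comp .snd) (primrec_ntTp.comp (fst.comp .fst) .snd).to₂)
    (primrec_contTp.comp (primrec_oneHot.comp .fst (fst.comp .snd)))

theorem primrec_replicate {α : Type*} [Primcodable α] (x : α) :
    Primrec fun n => List.replicate n x :=
  (list_map list_range (.const x : Primrec fun _ : ℕ × ℕ => x).to₂).of_eq fun n => by simp

theorem primrec_lowTp : Primrec₂ lowTp :=
  primrec_prods.comp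
    ((primrec_replicate idTp).comp (nat_add.comp .snd (.const 1)))
    (primrec_contTp.comp ((primrec_replicate true).comp .fst))

theorem primrec_meetTp : Primrec₂ meetTp :=
  (list_foldr .snd .fst (primrec_mul.comp
    (primrec_rdiv.comp (snd.comp .snd) (fst.comp .fst))
    (primrec_mul.comp (fst.comp .fst)
      (primrec_ldiv.comp (fst.comp .fst) (fst.comp .snd)))).to₂).of_eq fun ⟨C, l⟩ => by
      induction l with
      | nil => rfl
      | cons B l ih => exact congrArg (fun A => Tp.mul (.rdiv A C) (.mul C (.ldiv C B))) ih

theorem primrec_dualTp : Primrec₂ dualTp :=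
  primrec_ldiv.comp (primrec_mul.comp .snd (.const _))
    (primrec_prim.comp (nat_add.comp .fst (.const 5)))

theorem primrec_letterTp : Primrec fun x : (ℕ × ℕ) × ℕ × List (ℕ × List ℕ) =>
    letterTp x.1.1 x.1.2 x.2.1 x.2.2 :=
  primrec_rdiv.comp (.const _) <| primrec_rdiv.comp
    (primrec_prim.comp (nat_add.comp (fst.comp .snd) (.const 5))) <|
    primrec_mul.comp (.const _) <| primrec_meetTp.comp
      (primrec_dualTp.comp (fst.comp .snd) (primrec_lowTp.comp (fst.comp .fst) (snd.comp .fst)))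
      (list_map (snd.comp .snd) (primrec_dualTp.comp (fst.comp (snd.comp .fst))
        (primrec_ruleTp.comp (fst.comp (fst.comp .fst)) .snd)).to₂)

theorem primrec_lcNT : Primrec₂ lcNT := Primrec.encode

theorem primrec_unitEdges : Primrec unitEdges :=
  list_flatMap .id (Primrec.ite
    (Primrec.eq.comp (list_length.comp (snd.comp .snd)) (.const 1))
    (list_map (snd.comp .snd)
      (Primrec.pair .snd (sumInr.comp (fst.comp (snd.comp .fst)))).to₂)
    (.const [])).to₂

theorem primrec_addThrough : Primrec₂ addThrough :=
  list_append.comp .snd (list_flatMap .snd (list_flatMap (snd.comp .fst) (Primrec.ite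
    (PrimrecPred.and (Primrec.eq.comp (snd.comp (snd.comp .fst)) (fst.comp (fst.comp .fst)))
      (Primrec.eq.comp (fst.comp .snd) (fst.comp (fst.comp .fst))))
    (list_cons.comp (Primrec.pair (fst.comp (snd.comp .fst)) (snd.comp .snd)) (.const []))
    (.const [])).to₂).to₂)

theorem primrec_unitClosure : Primrec unitClosure :=
  list_foldr (list_map .id (sumInr.comp (fst.comp .snd)).to₂) primrec_unitEdges
    (primrec_addThrough.comp (fst.comp .snd) (snd.comp .snd)).to₂

theorem primrecPred_unitLE : PrimrecPred
    fun x : List (ℕ × List (ℕ ⊕ ℕ)) × (ℕ ⊕ ℕ) × (ℕ ⊕ ℕ) => UnitLE x.1 x.2.1 x.2.2 :=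
  (PrimrecPred.or (Primrec.eq.comp (fst.comp .snd) (snd.comp .snd))
    ((PrimrecRel.exists_mem_list (Primrec.eq (α := (ℕ ⊕ ℕ) × (ℕ ⊕ ℕ)))).comp
      (primrec_unitClosure.comp .fst) .snd)).of_eq fun x => by simp [UnitLE]

theorem primrec_completions : Primrec
    fun x : List (ℕ × List (ℕ ⊕ ℕ)) × (ℕ ⊕ ℕ) × (ℕ ⊕ ℕ) => completions x.1 x.2.1 x.2.2 :=
  list_append.comp
    (Primrec.ite (primrecPred_unitLE.comp
      (Primrec.pair .fst (Primrec.pair (snd.comp .snd) (fst.comp .snd)))) (.const [[]]) (.const []))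
    (list_cons.comp (list_cons.comp
      (primrec_lcNT.comp (fst.comp .snd) (option_some.comp (snd.comp .snd))) (.const []))
      (.const []))

theorem primrec_symbols : Primrec₂ symbols :=
  list_cons.comp (sumInr.comp .fst) (list_flatMap .snd
    (list_cons.comp (sumInr.comp (fst.comp .snd)) (snd.comp .snd)).to₂)

theorem primrec_goalRules : Primrec fun x : (ℕ × List (ℕ × List (ℕ ⊕ ℕ))) × ℕ =>
    goalRules x.1.1 x.1.2 x.2 :=
  list_flatMap (primrec_symbols.comp (fst.comp .fst) (snd.comp .fst)) (list_map
    (primrec_completions.comp (Primrec.pair (snd.comp (fst.comp .fst))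
      (Primrec.pair .snd (sumInl.comp (snd.comp .fst)))))
    (Primrec.pair (primrec_lcNT.comp (snd.comp .fst) (.const none)) .snd).to₂).to₂

theorem primrec_stepRules : Primrec fun x : (List (ℕ × List (ℕ ⊕ ℕ)) × ℕ) × ((ℕ ⊕ ℕ) × (ℕ ⊕ ℕ)) ×
      (ℕ × List (ℕ ⊕ ℕ)) × (ℕ ⊕ ℕ) × (ℕ ⊕ ℕ) =>
    stepRules x.1.1 x.1.2 x.2.1.1 x.2.1.2 x.2.2.1 x.2.2.2.1 x.2.2.2.2 := by
  refine Primrec.ite (primrecPred_unitLE.comp (Primrec.pair (fst.comp .fst)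
    (Primrec.pair (snd.comp (fst.comp .snd)) (fst.comp (snd.comp (snd.comp .snd))))))
    (list_flatMap (primrec_completions.comp (Primrec.pair (fst.comp .fst)
      (Primrec.pair (snd.comp (snd.comp (snd.comp .snd))) (sumInl.comp (snd.comp .fst))))) ?_)
    (.const [])
  refine list_map (primrec_completions.comp (Primrec.pair (fst.comp (fst.comp .fst))
    (Primrec.pair (fst.comp (fst.comp (snd.comp .fst)))
      (sumInr.comp (fst.comp (fst.comp (snd.comp (snd.comp .fst)))))))) ?_
  refine Primrec.pair (primrec_lcNT.comp (fst.comp (fst.comp (snd.comp (fst.comp .fst))))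
      (option_some.comp (snd.comp (fst.comp (snd.comp (fst.comp .fst)))))) ?_
  exact list_append.comp (list_append.comp (snd.comp .fst) (list_map
    (list_drop.comp (.const 2) (snd.comp (fst.comp (snd.comp (snd.comp (fst.comp .fst))))))
    (primrec_lcNT.comp .snd (.const none)).to₂)) .snd

theorem primrec_lcRules : Primrec fun x : (ℕ × List (ℕ × List (ℕ ⊕ ℕ))) × ℕ =>
    lcRules x.1.1 x.1.2 x.2 := by
  refine list_append.comp primrec_goalRules ?_
  refine list_flatMap (primrec_symbols.comp (fst.comp .fst) (snd.comp .fst)) ?_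
  refine list_flatMap (primrec_symbols.comp (fst.comp (fst.comp .fst))
    (snd.comp (fst.comp .fst))) ?_
  refine list_flatMap (snd.comp (fst.comp (fst.comp .fst))) ?_
  refine list_flatMap (optionToList.comp (list_getElem?.comp (snd.comp .snd) (.const 0))) ?_
  refine list_flatMap (optionToList.comp
    (list_getElem?.comp (snd.comp (snd.comp .fst)) (.const 1))) ?_
  -- the argument is `(((((x, Y), X), r), X'), c)`
  have h : Primrec fun y : ((((((ℕ × List (ℕ × List (ℕ ⊕ ℕ))) × ℕ) × (ℕ ⊕ ℕ)) × (ℕ ⊕ ℕ)) ×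
      (ℕ × List (ℕ ⊕ ℕ))) × (ℕ ⊕ ℕ)) × (ℕ ⊕ ℕ) => y.1.1.1.1.1 :=
    fst.comp (fst.comp (fst.comp (fst.comp .fst)))
  exact (primrec_stepRules.comp (Primrec.pair (Primrec.pair (snd.comp (fst.comp h)) (snd.comp h))
    (Primrec.pair (Primrec.pair (snd.comp (fst.comp (fst.comp (fst.comp .fst))))
      (snd.comp (fst.comp (fst.comp .fst))))
      (Primrec.pair (snd.comp (fst.comp .fst)) (Primrec.pair (snd.comp .fst) .snd))))).to₂

theorem primrec_numTerminals : Primrec CFGData.numTerminals :=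
  fst.comp (of_equiv (e := CFGData.equivProd))

theorem primrec_initial : Primrec CFGData.initial :=
  fst.comp (snd.comp (of_equiv (e := CFGData.equivProd)))

theorem primrec_rules : Primrec CFGData.rules :=
  snd.comp (snd.comp (of_equiv (e := CFGData.equivProd)))

theorem primrec_allRules : Primrec allRules :=
  list_flatMap (list_range.comp primrec_numTerminals) (primrec_lcRules.comp (Primrec.pair
    (Primrec.pair (primrec_initial.comp .fst) (primrec_rules.comp .fst)) .snd)).to₂

theorem primrec_ntBound : Primrec ntBound :=
  list_foldr primrec_allRules (.const 0) (nat_add.comp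
    (nat_add.comp (fst.comp (fst.comp .snd)) (.const 1)) (snd.comp .snd)).to₂

theorem primrec_lengthBound : Primrec lengthBound :=
  list_foldr primrec_allRules (.const 0) (nat_add.comp
    (list_length.comp (snd.comp (fst.comp .snd))) (snd.comp .snd)).to₂

theorem primrec_lambekGrammar : Primrec lambekGrammar :=
  Primrec.pair
    (list_map (list_range.comp primrec_numTerminals) (primrec_letterTp.comp (Primrec.pair
      (Primrec.pair (primrec_ntBound.comp .fst) (primrec_lengthBound.comp .fst))
      (Primrec.pair .snd (primrec_lcRules.comp (Primrec.pair
        (Primrec.pair (primrec_initial.comp .fst) (primrec_rules.comp .fst)) .snd))))).to₂)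
    (primrec_ntTp.comp primrec_ntBound
      (primrec_lcNT.comp (sumInr.comp primrec_initial) (.const none)))

end Computability

/-! ### Correctness of the construction -/

theorem Greibach.congr {R R' : ℕ → List (ℕ × List ℕ)} {κ w : List ℕ} (h : Greibach R κ w)
    (hR : ∀ a ∈ w, R a = R' a) : Greibach R' κ w := by
  induction h with
  | nil => exact .nil
  | @cons N b α κ u v hr _ _ ihα ihκ =>
    refine .cons (hR b (by simp) ▸ hr) (ihα fun a ha => hR a ?_) (ihκ fun a ha => hR a ?_) <;>
      simp [ha]

theorem le_foldr_add_of_mem {α : Type*} (f : α → ℕ) {l : List α} {x : α} (hx : x ∈ l) :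
    f x ≤ l.foldr (fun y m => f y + m) 0 := by
  induction l with
  | nil => simp at hx
  | cons y l ih =>
    rw [List.foldr_cons]
    rcases List.mem_cons.1 hx with rfl | h
    · exact Nat.le_add_right _ _
    · exact (ih h).trans (Nat.le_add_left _ _)

theorem derivable_assignTp_iff_gen {G : CFGData} (hG : G.EpsilonFree) {w : List ℕ}
    (hw : ∀ a ∈ w, a < G.numTerminals) :
    Derivable (w.map (assignTp G)) (targetTp G) ↔ Gen G.rules [.inr G.initial] w := by
  -- the bounds cover only the letters of the alphabet, so the other letters get no rules
  let R : ℕ → List (ℕ × List ℕ) := fun a =>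
    if a < G.numTerminals then lcRules G.initial G.rules a else []
  have hR : ∀ a ∈ w, R a = lcRules G.initial G.rules a := fun a ha => if_pos (hw a ha)
  have hmem : ∀ a, ∀ r ∈ R a, r ∈ allRules G := by
    intro a r hr
    by_cases ha : a < G.numTerminals
    · exact List.mem_flatMap.2 ⟨a, List.mem_range.2 ha, by simpa [R, ha] using hr⟩
    · simp [R, ha] at hr
  have h := derivable_letterTp_iff (R := R) (s := ntBound G) (L := lengthBound G)
    (fun a r hr => le_foldr_add_of_mem (fun r : ℕ × List ℕ => r.1 + 1) (hmem a r hr))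
    (fun a r hr => le_foldr_add_of_mem (fun r : ℕ × List ℕ => r.2.length) (hmem a r hr))
    (lcNT (.inr G.initial) none) w
  rw [List.map_congr_left (g := assignTp G) fun a ha => by rw [assignTp, hR a ha]] at h
  rw [targetTp, h, ← greibach_lcRules_iff hG]
  exact ⟨fun h => h.congr hR, fun h => h.congr fun a ha => (hR a ha).symm⟩

theorem CFGData.mem_toCFG_language_iff (G : CFGData) (w : List ℕ) :
    w ∈ G.toCFG.language ↔ Gen G.rules [.inr G.initial] w := by
  refine mem_language_iff_gen (g := G.toCFG) (R := G.rules) (fun x => ?_) w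
  have hc : ∀ γ : List (ℕ ⊕ ℕ), (γ.map toSymbol).map symbolToSum = γ := fun γ => by
    rw [List.map_map]
    conv_rhs => rw [← List.map_id γ]
    refine List.map_congr_left fun c _ => ?_
    cases c <;> rfl
  have hr : ∀ r : ContextFreeRule ℕ ℕ, r ∈ G.toCFG.rules ↔
      ∃ x ∈ G.rules, (⟨x.1, x.2.map toSymbol⟩ : ContextFreeRule ℕ ℕ) = r :=
    fun r => List.mem_toFinset.trans List.mem_map
  constructor
  · intro hx
    exact ⟨_, (hr _).2 ⟨x, hx, rfl⟩, Prod.ext rfl (hc x.2)⟩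
  · rintro ⟨_, h, rfl⟩
    obtain ⟨y, hy, rfl⟩ := (hr _).1 h
    have he : ((y.1, (y.2.map toSymbol).map symbolToSum) : ℕ × List (ℕ ⊕ ℕ)) = y :=
      Prod.ext rfl (hc y.2)
    exact he.symm ▸ hy

theorem language_assignTp {G : CFGData} (hG : G.EpsilonFree) :
    (⟨fun a => assignTp G a, targetTp G⟩ : UniqueGrammar (Fin G.numTerminals)).language =
      G.language := by
  ext w
  change Derivable (w.map fun a : Fin G.numTerminals => assignTp G a) _ ↔
    w.map Fin.val ∈ G.toCFG.language
  rw [G.mem_toCFG_language_iff, ← derivable_assignTp_iff_gen hG (by simp), List.map_map]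
  rfl

/-! ### Removal of empty rules -/

section Deletion
variable {T N : Type*} {R : List (N × List (T ⊕ N))}

open Classical in
/-- The lists obtained from a list of symbols by deletion of some nullable symbols. -/
noncomputable def deletions (R : List (N × List (T ⊕ N))) : List (T ⊕ N) → List (List (T ⊕ N))
  | [] => [[]]
  | c :: β => (deletions R β).map (c :: ·) ++ if Gen R [c] [] then deletions R β else []

open Classical in
/-- The rules obtained by deletion of nullable symbols, except the empty ones. -/
noncomputable def nonemptyRules (R : List (N × List (T ⊕ N))) : List (N × List (T ⊕ N)) :=
  R.flatMap fun r => ((deletions R r.2).filter (· ≠ [])).map fun γ => (r.1, γ)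

theorem mem_deletions_cons {c : T ⊕ N} {β β' : List (T ⊕ N)} :
    β' ∈ deletions R (c :: β) ↔
      (∃ γ ∈ deletions R β, c :: γ = β') ∨ Gen R [c] [] ∧ β' ∈ deletions R β := by
  simp [deletions]

theorem mem_nonemptyRules {B : N} {γ' : List (T ⊕ N)} :
    (B, γ') ∈ nonemptyRules R ↔ γ' ≠ [] ∧ ∃ γ, (B, γ) ∈ R ∧ γ' ∈ deletions R γ := by
  simp only [nonemptyRules, List.mem_flatMap, List.mem_map, List.mem_filter, decide_eq_true_eq,
    Prod.mk.injEq, Prod.exists]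
  constructor
  · rintro ⟨_, γ, hr, _, ⟨hγ, hne⟩, rfl, rfl⟩
    exact ⟨hne, γ, hr, hγ⟩
  · rintro ⟨hne, γ, hr, hγ⟩
    exact ⟨B, γ, hr, γ', ⟨hγ, hne⟩, rfl, rfl⟩

theorem Gen.of_mem_deletions {β β' : List (T ⊕ N)} {w : List T} (hβ : β' ∈ deletions R β)
    (h : Gen R β' w) : Gen R β w := by
  induction β generalizing β' w with
  | nil =>
    obtain rfl : β' = [] := by simpa [deletions] using hβ
    exact h
  | cons c β ih =>
    rcases mem_deletions_cons.1 hβ with ⟨γ, hγ, rfl⟩ | ⟨hc, hβ⟩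
    · obtain ⟨u, v, rfl, hu, hv⟩ := gen_cons_iff.1 h
      exact gen_cons_iff.2 ⟨u, v, rfl, hu, ih hγ hv⟩
    · exact gen_cons_iff.2 ⟨[], w, rfl, hc, ih hβ h⟩

theorem Gen.of_nonemptyRules {β : List (T ⊕ N)} {w : List T} (h : Gen (nonemptyRules R) β w) :
    Gen R β w := by
  induction h with
  | nil => exact .nil
  | letter _ ih => exact .letter ih
  | rule hr _ _ ihγ ihβ =>
    obtain ⟨-, γ, hr, hγ⟩ := mem_nonemptyRules.1 hr
    exact .rule hr (ihγ.of_mem_deletions hγ) ihβ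

theorem Gen.exists_mem_deletions {β : List (T ⊕ N)} {w : List T} (h : Gen R β w) :
    ∃ β' ∈ deletions R β, Gen (nonemptyRules R) β' w := by
  induction h with
  | nil => exact ⟨[], by simp [deletions], .nil⟩
  | letter _ ih =>
    obtain ⟨β', hβ, h⟩ := ih
    exact ⟨_, mem_deletions_cons.2 (Or.inl ⟨β', hβ, rfl⟩), .letter h⟩
  | @rule B γ β u v hr hγ _ ihγ ihβ =>
    obtain ⟨β', hβ', hv⟩ := ihβ
    rcases eq_or_ne u [] with rfl | hu
    · exact ⟨β', mem_deletions_cons.2 (Or.inr ⟨gen_nonterminal_iff.2 ⟨γ, hr, hγ⟩, hβ'⟩), hv⟩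
    · obtain ⟨γ', hγ', hu'⟩ := ihγ
      have hne : γ' ≠ [] := by
        rintro rfl
        cases hu'
        exact hu rfl
      exact ⟨_, mem_deletions_cons.2 (Or.inl ⟨β', hβ', rfl⟩),
        .rule (mem_nonemptyRules.2 ⟨hne, γ, hr, hγ'⟩) hu' hv⟩

theorem gen_nonemptyRules_iff {B : N} {w : List T} (hw : w ≠ []) :
    Gen (nonemptyRules R) [.inr B] w ↔ Gen R [.inr B] w := by
  refine ⟨Gen.of_nonemptyRules, fun h => ?_⟩
  obtain ⟨β', hβ', h⟩ := h.exists_mem_deletions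
  rcases mem_deletions_cons.1 hβ' with ⟨γ, hγ, rfl⟩ | ⟨-, hβ'⟩
  · obtain rfl : γ = [] := by simpa [deletions] using hγ
    exact h
  · obtain rfl : β' = [] := by simpa [deletions] using hβ'
    cases h
    exact absurd rfl hw

end Deletion

/-! ### Renaming of symbols -/

section Rename
variable {T T' N N' : Type*}

/-- The rules with letters renamed by `f` and nonterminals renamed by `g`. -/
def mapRules (f : T → T') (g : N → N') (R : List (N × List (T ⊕ N))) : List (N' × List (T' ⊕ N')) :=
  R.map (Prod.map g (List.map (Sum.map f g)))

theorem Gen.map {R : List (N × List (T ⊕ N))} (f : T → T') (g : N → N') {β : List (T ⊕ N)}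
    {w : List T} (h : Gen R β w) :
    Gen (mapRules f g R) (β.map (Sum.map f g)) (w.map f) := by
  induction h with
  | nil => exact .nil
  | letter _ ih => exact .letter ih
  | rule hr _ _ ihγ ihβ =>
    rw [List.map_append]
    exact .rule (List.mem_map.2 ⟨_, hr, rfl⟩) ihγ ihβ

theorem gen_mapRules_iff {R : List (N × List (T ⊕ N))} {f : T → T'} {f' : T' → T} {g : N → N'}
    {g' : N' → N} (hf : ∀ a, f' (f a) = a) {S : N} (hS : g' (g S) = S)
    (hg : ∀ r ∈ R, g' (g r.1) = r.1 ∧ ∀ B, .inr B ∈ r.2 → g' (g B) = B) {w : List T} :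
    Gen (mapRules f g R) [.inr (g S)] (w.map f) ↔ Gen R [.inr S] w := by
  refine ⟨fun h => ?_, fun h => h.map f g⟩
  have h := h.map f' g'
  have hR : mapRules f' g' (mapRules f g R) = R := by
    unfold mapRules
    rw [List.map_map]
    conv_rhs => rw [← List.map_id R]
    refine List.map_congr_left fun r hr => Prod.ext (hg r hr).1 ?_
    change (r.2.map _).map _ = r.2
    rw [List.map_map]
    conv_rhs => rw [← List.map_id r.2]
    refine List.map_congr_left fun c hc => ?_
    cases c with
    | inl a => exact congrArg Sum.inl (hf a)
    | inr B => exact congrArg Sum.inr ((hg r hr).2 B hc)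
  rw [hR, List.map_map, (funext hf : f' ∘ f = id), List.map_id] at h
  simpa [hS] using h

/-- Finitely many nonterminals can be numbered by natural numbers. -/
theorem exists_numbering (S : N) (R : List (N × List (T ⊕ N))) :
    ∃ (g : N → ℕ) (g' : ℕ → N), g' (g S) = S ∧
      ∀ r ∈ R, g' (g r.1) = r.1 ∧ ∀ B, .inr B ∈ r.2 → g' (g B) = B := by
  classical
  let l : List N := S :: R.flatMap fun r => r.1 :: r.2.filterMap Sum.getRight?
  have hl : ∀ B ∈ l, l.getD (l.idxOf B) S = B := fun B hB => by
    rw [List.getD_eq_getElem _ _ (List.idxOf_lt_length_of_mem hB), List.getElem_idxOf]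
  refine ⟨fun B => l.idxOf B, fun i => l.getD i S, hl S (by simp [l]),
    fun r hr => ⟨hl _ ?_, fun B hB => hl B ?_⟩⟩
  · exact List.mem_cons_of_mem _ (List.mem_flatMap.2 ⟨r, hr, by simp⟩)
  · refine List.mem_cons_of_mem _ (List.mem_flatMap.2 ⟨r, hr, List.mem_cons_of_mem _ ?_⟩)
    exact List.mem_filterMap.2 ⟨_, hB, rfl⟩

end Rename

theorem exists_uniqueGrammar {T : Type*} [Finite T] {L : Language T} (hL : L.IsContextFree)
    (hne : [] ∉ L) : ∃ g : UniqueGrammar T, g.language = L := by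
  obtain ⟨g, rfl⟩ := hL
  let R₀ : List (g.NT × List (T ⊕ g.NT)) :=
    g.rules.toList.map fun r => (r.input, r.output.map symbolToSum)
  have hR₀ : ∀ w, w ∈ g.language ↔ Gen R₀ [.inr g.initial] w :=
    mem_language_iff_gen fun x => by simp [R₀]
  obtain ⟨ν, ν', hS, hν⟩ := exists_numbering g.initial (nonemptyRules R₀)
  let e := Finite.equivFin T
  let G : CFGData := ⟨Nat.card T, ν g.initial, mapRules (fun a => (e a : ℕ)) ν (nonemptyRules R₀)⟩
  have hG : G.EpsilonFree := by
    intro r hr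
    obtain ⟨⟨B, γ⟩, hr', rfl⟩ := List.mem_map.1 hr
    simpa using (mem_nonemptyRules.1 hr').1
  refine ⟨⟨fun a => assignTp G (e a), targetTp G⟩, Set.ext fun w => ?_⟩
  change Derivable (w.map fun a => assignTp G (e a)) (targetTp G) ↔ w ∈ g.language
  rcases eq_or_ne w [] with rfl | hw
  · exact iff_of_false (fun h => h.ne_nil rfl) hne
  have : Nonempty T := ⟨w.head hw⟩
  have hinv : ∀ a, Function.invFun (fun a => (e a : ℕ)) (e a : ℕ) = a :=
    Function.leftInverse_invFun (Fin.val_injective.comp e.injective)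
  have hlt : ∀ a ∈ w.map fun a => (e a : ℕ), a < G.numTerminals := by
    intro a ha
    obtain ⟨b, -, rfl⟩ := List.mem_map.1 ha
    exact (e b).2
  rw [hR₀, ← gen_nonemptyRules_iff hw, ← gen_mapRules_iff hinv hS hν,
    ← derivable_assignTp_iff_gen hG hlt, List.map_map]
  rfl

end Lambek

theorem theorem1 :
    (∀ (T : Type*) [Finite T] (L : Language T), L.IsContextFree → [] ∉ L →
      ∃ g : Lambek.UniqueGrammar T, g.language = L) ∧
    (∃ F : Lambek.CFGData → List Lambek.Tp × Lambek.Tp, Computable F ∧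
      ∀ G : Lambek.CFGData, G.WellFormed → G.EpsilonFree →
        ∃ A : Fin G.numTerminals → Lambek.Tp,
          (F G).1 = List.ofFn A ∧
          (⟨A, (F G).2⟩ : Lambek.UniqueGrammar (Fin G.numTerminals)).language = G.language) := by
  refine ⟨fun T _ L hL hne => Lambek.exists_uniqueGrammar hL hne, Lambek.lambekGrammar,
    Lambek.primrec_lambekGrammar.to_comp, fun G _ hG => ⟨fun a => Lambek.assignTp G a, ?_,
      Lambek.language_assignTp hG⟩⟩
  change (List.range G.numTerminals).map (Lambek.assignTp G) = _
  rw [← List.map_coe_finRange_eq_range, List.map_map, List.ofFn_eq_map]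
  rfl
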